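/- Let $p$ be a prime, $\mathbb{F}_q$ a finite field of characteristic $p$, $\varphi(x)=\exp\big(2\pi i\,\mathrm{Tr}_{\mathbb{F}_q/\mathbb{F}_p}(x)/p\big)$, and for an $n\times n$ matrix $a$ over $\mathbb{F}_q$ let \[ K_n(a)=\sum_{x\in \mathrm{GL}_n(\mathbb{F}_q)}\varphi\big(\mathrm{tr}(ax+x^{-1})\big),\qquad K_1(\alpha)=\sum_{x\in\mathbb{F}_q^*}\varphi(\alpha x+x^{-1}). \] For a partition $\lambda$ of $n$ and $\alpha\in\mathbb{F}_q^*$ put $K_\lambda=K_\lambda(\alpha)=K_n(\alpha I+\bar a(\lambda))$, where $\bar a(\lambda)$ is the nilpotent matrix in Jordan normal form whose block sizes are the parts of $\lambda$ in non-decreasing order, and write $K=K_1(\alpha)$. **Theorem (Recursion algorithm).** Let $\lambda=[n_1^{k_1},\dots,n_{l-1}^{k_{l-1}},n_l^{k_l}]$ with $n_1<\dots<n_l$ be a partition of $n$ whose largest part $n_l\ge 2$ is repeated $k_l>1$ times. Then, for every finite field $\mathbb{F}_q$ and every $\alpha\in\mathbb{F}_q^*$, \[ K_\lambda =q^{n-1}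 K\, K_{\lambda'}-q^{2n-2}K_{\lambda''}-(q^{k_l-1}-1)\,q^{2n-2}\left( K_{\lambda''}-K_{\lambda'''}\right), \] where \[ \lambda'=[n_1^{k_1},\dots, n_{l-1}^{k_{l-1}},n_l-1,n_{l}^{k_l-1}],\quad \lambda''=[n_1^{k_1},\dots, n_{l-1}^{k_{l-1}},n_l-2,n_{l}^{k_l-1}],\quad \lambda'''=[n_1^{k_1},\dots, n_{l-1}^{k_{l-1}},(n_l-1)^2,n_{l}^{k_l-2}] \] are partitions of $n-1$, $n-2$ and $n-2$ respectively, reordered into a monotonic sequence if needed, and with the part $n_l-2$ deleted if it is $0$. Consequently, say that a polynomial $P\in\mathbb{Z}[A,G,K]$ expresses $K_\mu$ if $K_\mu(\alpha)=P(q,q-1,K_1(\alpha))$ for all finite fields $\mathbb{F}_q$ and all $\alpha\in\mathbb{F}_q^*$. If $P',P'',P'''$ express $K_{\lambda'},K_{\lambda''},K_{\lambda'''}$, then $A^{n-1}KP'-A^{2n-2}P''-(A^{k_l-1}-1)A^{2n-2}(P''-P''')$ expresses $K_\lambda$. -/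

import Mathlib

universe u

/-- The additive character `φ = φ₀ ∘ Tr_{F/𝔽_p}` of a finite field `F` of characteristic `p`,
where `φ₀ : 𝔽_p → ℂ` sends `1` to `exp (2πi / p)`. -/
noncomputable def fieldChar (p : ℕ) [Fact p.Prime] (F : Type u) [Field F] [Algebra (ZMod p) F]
    (x : F) : ℂ :=
  ZMod.stdAddChar (Algebra.trace (ZMod p) F x)

/-- The classical Kloosterman sum `K₁(α) = ∑_{x ∈ F^*} φ(α x + x⁻¹)`. -/
noncomputable def kloosterman (p : ℕ) [Fact p.Prime] (F : Type u) [Field F] [Algebra (ZMod p) F]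
    [Fintype F] (α : F) : ℂ :=
  open Classical in ∑ x : Fˣ, fieldChar p F (α * (x : F) + (x : F)⁻¹)

/-- The matrix Kloosterman sum `K_n(a) = ∑_{x ∈ GL_n(F)} φ(tr(a x + x⁻¹))`. -/
noncomputable def matrixKloosterman (p : ℕ) [Fact p.Prime] {F : Type u} [Field F]
    [Algebra (ZMod p) F] [Fintype F] {n : ℕ} (a : Matrix (Fin n) (Fin n) F) : ℂ :=
  open Classical in
  ∑ x : GL (Fin n) F,
    fieldChar p F (a * (x : Matrix (Fin n) (Fin n) F) +
      ((x⁻¹ : GL (Fin n) F) : Matrix (Fin n) (Fin n) F)).trace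

/-- The partial sum `N_i = n₁ + ⋯ + n_i` of the parts `n₁ ≤ n₂ ≤ ⋯ ≤ n_l` of a partition,
listed in non-decreasing order. -/
def partialSum {n : ℕ} (lam : n.Partition) (i : ℕ) : ℕ :=
  ((lam.parts.sort (· ≤ ·)).take i).sum

/-- The nilpotent matrix in Jordan normal form with block sizes `n₁ ≤ ⋯ ≤ n_l`:
the entry in (one-based) position `(j, j + 1)` is `0` if `j` is one of the `N_i` and `1` otherwise,
and all other entries vanish. -/
noncomputable def jordanNilpotent (F : Type u) [Field F] {n : ℕ} (lam : n.Partition) :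
    Matrix (Fin n) (Fin n) F :=
  open Classical in
  Matrix.of fun r c =>
    if (c : ℕ) = (r : ℕ) + 1 ∧ ¬ ∃ i, partialSum lam i = (r : ℕ) + 1 then 1 else 0

/-- `K_λ(α) = K_n(α I + ā(λ))`. -/
noncomputable def partitionKloosterman (p : ℕ) [Fact p.Prime] {F : Type u} [Field F]
    [Algebra (ZMod p) F] [Fintype F] {n : ℕ} (lam : n.Partition) (α : F) : ℂ :=
  matrixKloosterman p (Matrix.scalar (Fin n) α + jordanNilpotent F lam)

/-- `P ∈ ℤ[A, G, K]` (with `A = X 0`, `G = X 1`, `K = X 2`) is a polynomial expressing `K_λ`: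
`K_λ(α) = P(q, q - 1, K₁(α))` for all finite fields and all `α ≠ 0`. -/
def Expresses {n : ℕ} (P : MvPolynomial (Fin 3) ℤ) (lam : n.Partition) : Prop :=
  ∀ (p : ℕ) [Fact p.Prime] (F : Type u) [Field F] [Algebra (ZMod p) F] [Fintype F] (α : F),
    α ≠ 0 →
      partitionKloosterman p lam α =
        MvPolynomial.aeval ![(Fintype.card F : ℂ), (Fintype.card F : ℂ) - 1, kloosterman p F α] P

/-! Write `f = α + N` on `V` of dimension `n`, with `N` nilpotent of index `n_l`, and let `e` span
the bottom of a longest Jordan chain. Averaging the sum over the unipotents `1 + ξ ⊗ e` with `ξ e =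
0` keeps only those `x` with `α x e - x⁻¹ e ∈ ⟨e⟩` (`endKloosterman_eq_sum_mem_span`). For such `x`,
either `x` preserves the line `⟨e⟩`, or it preserves the plane spanned by `e` and `y = x⁻¹ e`,
acting there by a matrix with one free parameter `c`. Summing over all `x` with a given restriction
to a subspace `U` yields a power of `q`, a character value and the Kloosterman sum on `V ⧸ U`, or
zero if `U` is not `f`-stable (`sum_units_restrict`). Lines give `q^(n-1) K K_λ'`.

For the planes put `κ y` for the sum on `V ⧸ ⟨e, y⟩`, and let `N y₀ = e`, with `y₀` next to `e` in
its chain. Stability forces `y = s y₀ + z` with `z ∈ ker N`, and `∑_{s ≠ 0} χ(s/α) = -1` leaves the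
differences `κ z - κ (y₀ + z)`, without the first term when `z ∈ ⟨e⟩`. Kernel vectors of equal
height are conjugate under the centralizer of a nilpotent map (`exists_equiv_commute_apply_eq`);
applied in `V ⧸ ⟨e⟩`, this cancels every `z` of less than maximal height. The `q^(k_l)` vectors that
remain form the image of `N^(n_l - 1)`: those outside `⟨e⟩` give `K_λ'''`, and all of them give
`-K_λ''`. -/

open Module

/-! ### Orthogonality of additive characters -/

section CharacterSums

variable {F : Type*} [Field F] {χ : AddChar F ℂ}

/-- A nontrivial additive character of a field composed with a linear form sums to zero,
unless the form vanishes. -/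
theorem sum_addChar_linear (hχ : χ ≠ 1) {E : Type*} [AddCommGroup E] [Module F E] [Fintype E]
    (L : E →ₗ[F] F) [Decidable (L = 0)] :
    ∑ v, χ (L v) = if L = 0 then (Fintype.card E : ℂ) else 0 := by
  split_ifs with h
  · simp [h]
  · obtain ⟨v, hv⟩ : ∃ v, L v ≠ 0 := by
      by_contra! h'
      exact h (LinearMap.ext h')
    obtain ⟨a, ha⟩ := AddChar.ne_one_iff.1 hχ
    have h1 : (χ.compAddMonoidHom L.toAddMonoidHom) ≠ 0 := by
      intro h0
      apply ha
      have := DFunLike.congr_fun h0 ((a / L v) • v)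
      simpa [hv] using this
    exact AddChar.sum_eq_zero_iff_ne_zero.2 h1

theorem sum_eq_add_sum_units [Fintype F] [Fintype Fˣ] (H : F → ℂ) :
    ∑ s, H s = H 0 + ∑ s : Fˣ, H s := by
  classical
  rw [← Finset.add_sum_erase _ _ (Finset.mem_univ 0)]
  congr 1
  symm
  refine Finset.sum_bij (fun t _ => (t : F)) (by simp) (by simp [Units.ext_iff]) ?_ (by simp)
  intro b hb
  exact ⟨Units.mk0 b (by simpa using hb), by simp, rfl⟩

/-- The full sum over `F` vanishes and its term at zero is `1`. This `-1` is the source of the minus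
sign in front of `K_λ''`. -/
theorem sum_addChar_div_units (hχ : χ ≠ 1) [Fintype F] [Fintype Fˣ] {α : F} (hα : α ≠ 0) :
    ∑ t : Fˣ, χ ((t : F) / α) = -1 := by
  classical
  have h := sum_addChar_linear hχ (LinearMap.mulRight F α⁻¹)
  rw [if_neg (fun h0 => by
    have := LinearMap.congr_fun h0 α
    simp [hα] at this)] at h
  rw [sum_eq_add_sum_units] at h
  simp only [LinearMap.mulRight_apply, ← div_eq_mul_inv, zero_div, AddChar.map_zero_eq_one] at h
  rw [eq_neg_iff_add_eq_zero, add_comm, h]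

end CharacterSums

/-! ### Kloosterman sums of endomorphisms and of their quotients -/

section Endomorphisms

variable {F : Type*} [Field F] (χ : AddChar F ℂ)

/-- The Kloosterman sum of an endomorphism `f` of a vector space `V`. -/
noncomputable def endKloosterman {V : Type*} [AddCommGroup V] [Module F V] (f : End F V) : ℂ :=
  -- A finite-support sum needs no `Fintype` instance, so the value depends only on `V`, `f` and
  -- `χ`.
  ∑ᶠ x : (End F V)ˣ, χ (LinearMap.trace F V (f * (x : End F V) + ((x⁻¹ : (End F V)ˣ) : End F V)))

theorem endKloosterman_congr {V W : Type*} [AddCommGroup V] [Module F V] [AddCommGroup W]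
    [Module F W] (e : V ≃ₗ[F] W) {f : End F V} {g : End F W} (h : ∀ v, e (f v) = g (e v)) :
    endKloosterman χ f = endKloosterman χ g := by
  have hg : g = e.conj f := by
    ext w
    simp [LinearEquiv.conj_apply, h]
  unfold endKloosterman
  refine finsum_eq_of_bijective (Units.mapEquiv (LinearEquiv.conjRingEquiv e).toMulEquiv)
    (Equiv.bijective _) fun x => ?_
  rw [hg, ← LinearMap.trace_conj' _ e]
  congr 2
  ext w
  simp [LinearEquiv.conj_apply]
  rfl

theorem endKloosterman_eq_sum_matrix {V ι : Type*} [AddCommGroup V] [Module F V] [Fintype ι]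
    [DecidableEq ι] [Fintype (Matrix ι ι F)ˣ] (b : Basis ι F V) (f : End F V) :
    endKloosterman χ f = ∑ x : (Matrix ι ι F)ˣ,
      χ ((LinearMap.toMatrix b b f * (x : Matrix ι ι F) +
        ((x⁻¹ : (Matrix ι ι F)ˣ) : Matrix ι ι F)).trace) := by
  rw [← finsum_eq_sum_of_fintype]
  unfold endKloosterman
  refine finsum_eq_of_bijective
    (Units.mapEquiv (LinearMap.toMatrixAlgEquiv b).toRingEquiv.toMulEquiv)
    (Equiv.bijective _) fun x => ?_
  rw [LinearMap.trace_eq_matrix_trace F b, map_add, LinearMap.toMatrix_mul]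
  rfl

/-- The Kloosterman sum of the endomorphism that `f` induces on `V ⧸ U`, and `0` if `U` is not
`f`-stable. -/
noncomputable def quotKloosterman {V : Type*} [AddCommGroup V] [Module F V] (f : End F V)
    (U : Submodule F V) : ℂ :=
  open Classical in
  -- The default `0` is the value that the sum over automorphisms with prescribed restriction to `U`
  -- takes when `U` is not stable, so later sums need no stability condition.
  if h : U ≤ U.comap f then endKloosterman χ (U.mapQ U f h) else 0

theorem quotKloosterman_eq {V W : Type*} [AddCommGroup V] [Module F V] [AddCommGroup W]
    [Module F W] {f : End F V} {U : Submodule F V} {g : End F W} (π : V →ₗ[F] W)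
    (hπ : Function.Surjective π) (hU : LinearMap.ker π = U) (h : ∀ v, π (f v) = g (π v)) :
    quotKloosterman χ f U = endKloosterman χ g := by
  subst hU
  have hs : LinearMap.ker π ≤ (LinearMap.ker π).comap f := by
    intro v hv
    simp_all
  rw [quotKloosterman, dif_pos hs]
  refine endKloosterman_congr χ (π.quotKerEquivOfSurjective hπ) fun v => ?_
  induction v using Submodule.Quotient.induction_on with
  | H v => exact h v

/-- The third isomorphism theorem: planes through `e` can be treated as lines in the quotient by
`⟨e⟩`. -/
theorem quotKloosterman_comap {V W : Type*} [AddCommGroup V] [Module F V] [AddCommGroup W]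
    [Module F W] {f : End F V} {g : End F W} (π : V →ₗ[F] W)
    (hπ : Function.Surjective π) (h : ∀ v, π (f v) = g (π v)) (U : Submodule F W)
    (hU : U ≤ U.comap g) :
    quotKloosterman χ f (U.comap π) = quotKloosterman χ g U := by
  conv_rhs => rw [quotKloosterman, dif_pos hU]
  refine quotKloosterman_eq χ (U.mkQ ∘ₗ π) (U.mkQ_surjective.comp hπ) ?_ fun v => ?_
  · rw [LinearMap.ker_comp, Submodule.ker_mkQ]
  · simp [h]

end Endomorphisms

/-! ### Sums over block triangular matrices -/

section Blocks

variable {F : Type*} [Field F] {χ : AddChar F ℂ} {ι κ : Type*} [Fintype ι] [Fintype κ]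
  [DecidableEq ι] [DecidableEq κ]

/-- The invertible block upper triangular matrix with given diagonal blocks. -/
def blockUnit (g : (Matrix ι ι F)ˣ) (b : Matrix ι κ F) (x : (Matrix κ κ F)ˣ) :
    (Matrix (ι ⊕ κ) (ι ⊕ κ) F)ˣ where
  val := Matrix.fromBlocks g b 0 x
  inv := Matrix.fromBlocks ((g⁻¹ : (Matrix ι ι F)ˣ) : Matrix ι ι F)
    (-(((g⁻¹ : (Matrix ι ι F)ˣ) : Matrix ι ι F) * b * ((x⁻¹ : (Matrix κ κ F)ˣ) : Matrix κ κ F))) 0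
    ((x⁻¹ : (Matrix κ κ F)ˣ) : Matrix κ κ F)
  val_inv := by
    simp [Matrix.fromBlocks_multiply, ← Matrix.mul_assoc]
  inv_val := by
    simp [Matrix.fromBlocks_multiply, Matrix.mul_assoc]

open scoped Classical in
/-- The sum over the invertible matrices with prescribed first block column `(g, 0)`. -/
theorem sum_units_blocks [Fintype F] (hχ : χ ≠ 1) [Fintype (Matrix (ι ⊕ κ) (ι ⊕ κ) F)ˣ]
    [Fintype (Matrix κ κ F)ˣ]
    (a : Matrix (ι ⊕ κ) (ι ⊕ κ) F) (g : (Matrix ι ι F)ˣ) :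
    (∑ x : (Matrix (ι ⊕ κ) (ι ⊕ κ) F)ˣ,
      if (x : Matrix (ι ⊕ κ) (ι ⊕ κ) F).toBlocks₁₁ = g ∧
          (x : Matrix (ι ⊕ κ) (ι ⊕ κ) F).toBlocks₂₁ = 0 then
        χ ((a * (x : Matrix (ι ⊕ κ) (ι ⊕ κ) F) +
          ((x⁻¹ : (Matrix (ι ⊕ κ) (ι ⊕ κ) F)ˣ) : Matrix (ι ⊕ κ) (ι ⊕ κ) F)).trace) else 0) =
    if a.toBlocks₂₁ = 0 then
      (Fintype.card F : ℂ) ^ (Fintype.card ι * Fintype.card κ) *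
        χ ((a.toBlocks₁₁ * (g : Matrix ι ι F) + ((g⁻¹ : (Matrix ι ι F)ˣ) : Matrix ι ι F)).trace) *
        ∑ x : (Matrix κ κ F)ˣ, χ ((a.toBlocks₂₂ * (x : Matrix κ κ F) +
          ((x⁻¹ : (Matrix κ κ F)ˣ) : Matrix κ κ F)).trace)
    else 0 := by
  -- In block triangular coordinates the upper right block `b` enters the trace only through `tr(a₂₁
  -- b)`, as it affects no diagonal block of the inverse. Summing over `b` therefore forces `a₂₁ =
  -- 0`.
  rw [← Fintype.sum_of_injective
    (fun y : Matrix ι κ F × (Matrix κ κ F)ˣ => blockUnit g y.1 y.2) ?_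
    (fun y => χ ((a.toBlocks₁₁ * (g : Matrix ι ι F) +
        ((g⁻¹ : (Matrix ι ι F)ˣ) : Matrix ι ι F)).trace) *
      χ (((Matrix.traceLinearMap κ F F) ∘ₗ (mulLeftLinearMap κ F a.toBlocks₂₁)) y.1) *
      χ ((a.toBlocks₂₂ * (y.2 : Matrix κ κ F) +
          ((y.2⁻¹ : (Matrix κ κ F)ˣ) : Matrix κ κ F)).trace)) _ ?_ ?_]
  · rw [Fintype.sum_prod_type]
    simp_rw [← Finset.mul_sum, ← Finset.sum_mul, ← Finset.mul_sum]
    rw [sum_addChar_linear hχ]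
    have h0 : (Matrix.traceLinearMap κ F F) ∘ₗ (mulLeftLinearMap κ F a.toBlocks₂₁) = 0 ↔
        a.toBlocks₂₁ = 0 := by
      constructor
      · intro h
        exact Matrix.ext_iff_trace_mul_right.2 fun x => by
          simpa using LinearMap.congr_fun h x
      · rintro h
        ext
        simp [h]
    simp only [h0]
    split_ifs
    · rw [show Fintype.card (Matrix ι κ F) = Fintype.card F ^ (Fintype.card ι * Fintype.card κ) by
        rw [← Nat.card_eq_fintype_card, Matrix]
        simp [pow_mul, pow_right_comm]]
      push_cast
      ring
    · simp
  · rintro ⟨b, x⟩ ⟨b', x'⟩ h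
    have h' := congrArg Units.val h
    simp only [blockUnit, Matrix.fromBlocks_inj] at h'
    exact Prod.ext h'.2.1 (Units.ext h'.2.2.2)
  · intro x hx
    rw [if_neg]
    rintro ⟨h1, h2⟩
    apply hx
    have hx' := Matrix.fromBlocks_toBlocks (x : Matrix (ι ⊕ κ) (ι ⊕ κ) F)
    rw [h1, h2] at hx'
    have hu : IsUnit (x : Matrix (ι ⊕ κ) (ι ⊕ κ) F) := x.isUnit
    rw [← hx', Matrix.isUnit_fromBlocks_zero₂₁] at hu
    obtain ⟨d, hd⟩ := hu.2
    refine ⟨((x : Matrix (ι ⊕ κ) (ι ⊕ κ) F).toBlocks₁₂, d), Units.ext ?_⟩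
    refine Eq.trans ?_ hx'
    simp only [blockUnit, hd]
  · rintro ⟨b, x⟩
    rw [if_pos (by simp [blockUnit])]
    rw [← AddChar.map_add_eq_mul, ← AddChar.map_add_eq_mul]
    congr 1
    conv_rhs => rw [← Matrix.fromBlocks_toBlocks a]
    change _ = Matrix.trace (_ * Matrix.fromBlocks _ _ _ _ + Matrix.fromBlocks _ _ _ _)
    rw [Matrix.fromBlocks_multiply, Matrix.fromBlocks_add]
    simp [Matrix.trace, Finset.sum_add_distrib]
    ring

end Blocks

/-! ### Automorphisms with prescribed restriction, and unipotent averaging -/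

section Parabolic

variable {F : Type*} [Field F] {χ : AddChar F ℂ}
  {V : Type*} [AddCommGroup V] [Module F V]

theorem Module.Basis.mem_span_range_inl {ι κ : Type*} (b : Basis (ι ⊕ κ) F V) (v : V) :
    v ∈ Submodule.span F (Set.range (b ∘ Sum.inl)) ↔ ∀ k, b.repr v (Sum.inr k) = 0 := by
  rw [Set.range_comp, Basis.mem_span_image]
  constructor
  · intro h k
    by_contra h0
    simpa using h (Finsupp.mem_support_iff.2 h0)
  · intro h i hi
    rcases i with i | k
    · simp
    · exact absurd (h k) (Finsupp.mem_support_iff.1 hi)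

open scoped Classical in
-- In the basis `b`, the block `a₂₁` vanishes exactly when the span is `f`-stable, and then `a₂₂` is
-- the matrix induced on the quotient.
theorem sum_units_basis [Fintype F] [Fintype (End F V)ˣ] {ι κ : Type*} [Fintype ι] [Fintype κ]
    [DecidableEq ι] [DecidableEq κ] (hχ : χ ≠ 1) (b : Basis (ι ⊕ κ) F V) (f : End F V)
    (g : (Matrix ι ι F)ˣ) :
    (∑ x : (End F V)ˣ,
      if ∀ i, (x : End F V) (b (Sum.inl i)) = ∑ j, (g : Matrix ι ι F) j i • b (Sum.inl j) then
        χ (LinearMap.trace F V (f * (x : End F V) + ((x⁻¹ : (End F V)ˣ) : End F V))) else 0) =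
      (Fintype.card F : ℂ) ^ (Fintype.card ι * Fintype.card κ) *
        χ (((LinearMap.toMatrix b b f).toBlocks₁₁ * (g : Matrix ι ι F) +
          ((g⁻¹ : (Matrix ι ι F)ˣ) : Matrix ι ι F)).trace) *
        quotKloosterman χ f (Submodule.span F (Set.range (b ∘ Sum.inl))) := by
  have hq : quotKloosterman χ f (Submodule.span F (Set.range (b ∘ Sum.inl))) =
      if (LinearMap.toMatrix b b f).toBlocks₂₁ = 0 then
        ∑ x : (Matrix κ κ F)ˣ, χ (((LinearMap.toMatrix b b f).toBlocks₂₂ * (x : Matrix κ κ F) +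
          ((x⁻¹ : (Matrix κ κ F)ˣ) : Matrix κ κ F)).trace) else 0 := by
    split_ifs with h0
    · have h1 := endKloosterman_eq_sum_matrix χ (Pi.basisFun F κ)
        (Matrix.toLin' (LinearMap.toMatrix b b f).toBlocks₂₂)
      rw [← Matrix.toLin_eq_toLin', LinearMap.toMatrix_toLin] at h1
      rw [← h1]
      refine quotKloosterman_eq χ ((LinearMap.funLeft F F Sum.inr) ∘ₗ b.equivFun.toLinearMap)
        ?_ ?_ fun v => ?_
      · exact (LinearMap.funLeft_surjective_of_injective F F (Sum.inr : κ → ι ⊕ κ) Sum.inr_injective).comp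
          b.equivFun.surjective
      · ext v
        rw [b.mem_span_range_inl]
        simp [funext_iff, LinearMap.funLeft_apply]
      · ext k
        have h2 := congrFun (LinearMap.toMatrix_mulVec_repr b b f v) (Sum.inr k)
        simp only [LinearMap.coe_comp, Function.comp_apply, LinearMap.funLeft_apply,
          LinearEquiv.coe_coe, Basis.equivFun_apply, Matrix.toLin_eq_toLin', Matrix.toLin'_apply]
        rw [← h2, Matrix.mulVec, dotProduct, Fintype.sum_sum_type, Matrix.mulVec, dotProduct]
        rw [Finset.sum_eq_zero, zero_add]
        · rfl
        · intro i _
          have := congrFun (congrFun h0 k) i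
          simp only [Matrix.toBlocks₂₁, Matrix.of_apply, Matrix.zero_apply] at this
          rw [this, zero_mul]
    · rw [quotKloosterman, dif_neg]
      intro h
      apply h0
      ext k i
      have h1 := h (Submodule.subset_span ⟨i, rfl⟩)
      rw [Submodule.mem_comap, b.mem_span_range_inl] at h1
      simpa [Matrix.toBlocks₂₁, LinearMap.toMatrix_apply] using h1 k
  rw [hq, mul_ite, mul_zero, ← sum_units_blocks hχ]
  refine Fintype.sum_equiv
    (Units.mapEquiv (LinearMap.toMatrixAlgEquiv b).toRingEquiv.toMulEquiv).toEquiv _ _ fun x => ?_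
  refine if_congr ?_ ?_ rfl
  · change _ ↔ (LinearMap.toMatrix b b x).toBlocks₁₁ = _ ∧ (LinearMap.toMatrix b b x).toBlocks₂₁ = _
    simp only [← Matrix.ext_iff, Matrix.toBlocks₁₁, Matrix.toBlocks₂₁, Matrix.of_apply,
      LinearMap.toMatrix_apply, Matrix.zero_apply]
    have key : ∀ i, (x : End F V) (b (Sum.inl i)) = ∑ j, (g : Matrix ι ι F) j i • b (Sum.inl j) ↔
        (∀ j, b.repr ((x : End F V) (b (Sum.inl i))) (Sum.inl j) = (g : Matrix ι ι F) j i) ∧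
        (∀ k, b.repr ((x : End F V) (b (Sum.inl i))) (Sum.inr k) = 0) := by
      intro i
      rw [← b.repr.injective.eq_iff, Finsupp.ext_iff, Sum.forall]
      simp [Finsupp.single_apply]
    simp only [key]
    grind
  · rw [LinearMap.trace_eq_matrix_trace F b, map_add, LinearMap.toMatrix_mul]
    rfl

open scoped Classical in
/-- The sum over the automorphisms of `V` with prescribed restriction to a subspace. -/
theorem sum_units_restrict [Fintype F] [Finite V] [Fintype (End F V)ˣ] {ι : Type*} [Fintype ι]
    [DecidableEq ι] (hχ : χ ≠ 1) {v : ι → V} (hv : LinearIndependent F v) (f : End F V)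
    (g : (Matrix ι ι F)ˣ) (A : Matrix ι ι F)
    (hA : (∀ i, f (v i) ∈ Submodule.span F (Set.range v)) → ∀ i, f (v i) = ∑ j, A j i • v j) :
    (∑ x : (End F V)ˣ,
      if ∀ i, (x : End F V) (v i) = ∑ j, (g : Matrix ι ι F) j i • v j then
        χ (LinearMap.trace F V (f * (x : End F V) + ((x⁻¹ : (End F V)ˣ) : End F V))) else 0) =
      (Fintype.card F : ℂ) ^ (Fintype.card ι * (finrank F V - Fintype.card ι)) *
        χ ((A * (g : Matrix ι ι F) + ((g⁻¹ : (Matrix ι ι F)ˣ) : Matrix ι ι F)).trace) *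
        quotKloosterman χ f (Submodule.span F (Set.range v)) := by
  let b := Basis.sumExtend hv
  have hb : b ∘ Sum.inl = v := by
    ext i
    simp only [b, Basis.sumExtend, Function.comp_apply, Basis.reindex_apply, Basis.extend_apply_self]
    rfl
  have : Finite (ι ⊕ Basis.sumExtendIndex hv) := Module.Finite.finite_basis b
  have : Finite (Basis.sumExtendIndex hv) := Finite.of_injective _ (Sum.inr_injective (α := ι))
  have := Fintype.ofFinite (Basis.sumExtendIndex hv)
  have hc : finrank F V - Fintype.card ι = Fintype.card (Basis.sumExtendIndex hv) := by
    rw [finrank_eq_card_basis b, Fintype.card_sum]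
    simp
  have hb' : ∀ i, b (Sum.inl i) = v i := fun i => congrFun hb i
  have h := sum_units_basis hχ b f g
  rw [hb, ← hc] at h
  simp only [hb'] at h
  rw [h]
  -- If the span is not stable both sides vanish, so `A` has to describe `f` only in the stable
  -- case.
  by_cases hs : ∀ i, f (v i) ∈ Submodule.span F (Set.range v)
  · have hA' : (LinearMap.toMatrix b b f).toBlocks₁₁ = A := by
      ext j i
      simp only [Matrix.toBlocks₁₁, Matrix.of_apply, LinearMap.toMatrix_apply, hb', hA hs i]
      simp [← hb', Finsupp.single_apply]
    rw [hA']
  · have : quotKloosterman χ f (Submodule.span F (Set.range v)) = 0 := by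
      rw [quotKloosterman, dif_neg]
      intro h
      exact hs fun i => h (Submodule.subset_span ⟨i, rfl⟩)
    simp [this]

/-- The transvection-like automorphism `v ↦ v + ξ v • e`, where `ξ e = 0`. -/
def rankOneUnit (e : V) (ξ : V →ₗ[F] F) (h : ξ e = 0) : (End F V)ˣ where
  val := 1 + ξ.smulRight e
  inv := 1 - ξ.smulRight e
  val_inv := by ext v; simp [h]
  inv_val := by ext v; simp [h]

open scoped Classical in
-- Replacing `x` by `(1 + ξ ⊗ e) x` adds `ξ (x f e - x⁻¹ e)` to the trace. Averaging over all `ξ`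
-- that vanish at `e` kills `x` unless this vector lies in the double annihilator of `e`, which is
-- its span.
theorem endKloosterman_eq_sum_mem_span [Finite V] [Finite F] [Fintype (End F V)ˣ]
    (hχ : χ ≠ 1) (f : End F V) (e : V) :
    endKloosterman χ f = ∑ x : (End F V)ˣ,
      if (x : End F V) (f e) - ((x⁻¹ : (End F V)ˣ) : End F V) e ∈ Submodule.span F {e} then
        χ (LinearMap.trace F V (f * (x : End F V) + ((x⁻¹ : (End F V)ˣ) : End F V))) else 0 := by
  let D := (Submodule.span F {e}).dualAnnihilator
  have hD : ∀ ξ ∈ D, ξ e = 0 := fun ξ hξ =>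
    (Submodule.mem_dualAnnihilator ξ).1 hξ e (Submodule.mem_span_singleton_self e)
  have : Finite (Dual F V) := Finite.of_injective _ DFunLike.coe_injective
  have := Fintype.ofFinite D
  set G : (End F V)ˣ → ℂ := fun x =>
    χ (LinearMap.trace F V (f * (x : End F V) + ((x⁻¹ : (End F V)ˣ) : End F V))) with hG
  let w : (End F V)ˣ → V := fun x => (x : End F V) (f e) - ((x⁻¹ : (End F V)ˣ) : End F V) e
  let L : (End F V)ˣ → D →ₗ[F] F := fun x => (Dual.eval F V (w x)) ∘ₗ D.subtype
  have hL : ∀ x, L x = 0 ↔ w x ∈ Submodule.span F {e} := by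
    intro x
    rw [← Subspace.forall_mem_dualAnnihilator_apply_eq_zero_iff]
    exact ⟨fun h ξ hξ => LinearMap.congr_fun h ⟨ξ, hξ⟩, fun h => LinearMap.ext fun ξ => h ξ ξ.2⟩
  have hcard : (Fintype.card D : ℂ) ≠ 0 := by
    exact_mod_cast Fintype.card_ne_zero
  have hshift : ∀ (ξ : D) x, G (rankOneUnit e ξ (hD ξ ξ.2) * x) = G x * χ (L x ξ) := by
    intro ξ x
    simp only [hG, ← AddChar.map_add_eq_mul]
    congr 1
    have h1 : f * ((rankOneUnit e ξ (hD ξ ξ.2) * x : (End F V)ˣ) : End F V) +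
        (((rankOneUnit e ξ (hD ξ ξ.2) * x)⁻¹ : (End F V)ˣ) : End F V) =
        (f * (x : End F V) + ((x⁻¹ : (End F V)ˣ) : End F V)) +
        (((ξ : Dual F V) ∘ₗ (x : End F V)).smulRight (f e) -
          (ξ : Dual F V).smulRight (((x⁻¹ : (End F V)ˣ) : End F V) e)) := by
      rw [mul_inv_rev]
      ext v
      change f ((x : End F V) v + (ξ : Dual F V) ((x : End F V) v) • e) +
        ((x⁻¹ : (End F V)ˣ) : End F V) (v - (ξ : Dual F V) v • e) = _
      simp
      abel
    rw [h1, map_add, map_sub, LinearMap.trace_smulRight, LinearMap.trace_smulRight]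
    simp [L, w]
  refine mul_left_cancel₀ hcard ?_
  calc (Fintype.card D : ℂ) * endKloosterman χ f
      = ∑ ξ : D, ∑ x, G x := by
        rw [endKloosterman, finsum_eq_sum_of_fintype]
        simp [hG]
    _ = ∑ ξ : D, ∑ x, G x * χ (L x ξ) := by
        refine Finset.sum_congr rfl fun ξ _ => ?_
        rw [← Equiv.sum_comp (Equiv.mulLeft (rankOneUnit e ξ (hD ξ ξ.2))) G]
        exact Finset.sum_congr rfl fun x _ => hshift ξ x
    _ = ∑ x, G x * ∑ ξ : D, χ (L x ξ) := by
        rw [Finset.sum_comm]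
        simp_rw [Finset.mul_sum]
    _ = _ := by
        rw [Finset.mul_sum]
        refine Finset.sum_congr rfl fun x _ => ?_
        rw [sum_addChar_linear (E := D) hχ (L x)]
        change (G x * if L x = 0 then _ else _) = _ * (if w x ∈ _ then G x else _)
        by_cases h : L x = 0
        · rw [if_pos h, if_pos ((hL x).1 h), mul_comm]
        · rw [if_neg h, if_neg ((hL x).not.1 h), mul_zero, mul_zero]

end Parabolic

/-! ### Splitting into stable lines and stable planes -/

section Recursion

variable {F : Type*} [Field F] {χ : AddChar F ℂ}
  {V : Type*} [AddCommGroup V] [Module F V]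

open scoped Classical in
/-- The automorphisms with `α x e - x⁻¹ e ∈ ⟨e⟩` either have `e` as an eigenvector, or send
`y = x⁻¹ e ∉ ⟨e⟩` to `e` and `e` to `α⁻¹ (y + c e)`. -/
theorem ite_mem_span_eq [Fintype F] [Fintype V] {e : V} (he : e ≠ 0) {α : F} (hα : α ≠ 0)
    (x : (End F V)ˣ) (z : ℂ) :
    (if (x : End F V) (α • e) - ((x⁻¹ : (End F V)ˣ) : End F V) e ∈ Submodule.span F {e} then z
      else 0) =
    (∑ s : Fˣ, if (x : End F V) e = (s : F) • e then z else 0) +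
    ∑ y : V, if y ∈ Submodule.span F {e} then 0 else
      ∑ c : F, if (x : End F V) e = (c / α) • e + α⁻¹ • y ∧ (x : End F V) y = e then z else 0 := by
  have hx : ∀ v, (x : End F V) (((x⁻¹ : (End F V)ˣ) : End F V) v) = v := fun v =>
    LinearMap.congr_fun x.mul_inv v
  have hx' : ∀ v, ((x⁻¹ : (End F V)ˣ) : End F V) ((x : End F V) v) = v := fun v =>
    LinearMap.congr_fun x.inv_mul v
  set y₀ := ((x⁻¹ : (End F V)ˣ) : End F V) e with hy₀
  have hy : ∀ y, (x : End F V) y = e → y = y₀ := fun y h => by rw [hy₀, ← h, hx']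
  -- The condition `x y = e` determines `y`, so only `y₀ = x⁻¹ e` contributes.
  rw [Fintype.sum_eq_single (a := y₀) (f := fun y => if y ∈ Submodule.span F {e} then (0 : ℂ) else
      ∑ c : F, if (x : End F V) e = (c / α) • e + α⁻¹ • y ∧ (x : End F V) y = e then z else 0)]
  · by_cases hm : y₀ ∈ Submodule.span F {e}
    · rw [if_pos hm, add_zero]
      obtain ⟨t, ht⟩ := Submodule.mem_span_singleton.1 hm
      have ht0 : t ≠ 0 := by
        rintro rfl
        apply he
        rw [← hx e, ← hy₀, ← ht]
        simp
      have hxe : (x : End F V) e = t⁻¹ • e := by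
        have := hx e
        rw [← hy₀, ← ht, map_smul] at this
        rw [eq_inv_smul_iff₀ ht0, this]
      rw [if_pos, Fintype.sum_eq_single (Units.mk0 t⁻¹ (inv_ne_zero ht0)), Units.val_mk0, if_pos hxe]
      · intro s hs
        rw [if_neg]
        intro h
        apply hs
        rw [hxe] at h
        exact Units.ext (smul_left_injective F he h).symm
      · refine Submodule.sub_mem _ ?_ hm
        rw [map_smul, hxe]
        exact Submodule.smul_mem _ _
          (Submodule.smul_mem _ _ (Submodule.mem_span_singleton_self e))
    · rw [if_neg hm, Finset.sum_eq_zero, zero_add]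
      · have key : ∀ c : F, ((x : End F V) e = (c / α) • e + α⁻¹ • y₀ ∧ (x : End F V) y₀ = e) ↔
            c • e = (x : End F V) (α • e) - y₀ := by
          intro c
          rw [and_iff_left (hx e), map_smul, eq_sub_iff_add_eq]
          have : (c / α) • e + α⁻¹ • y₀ = α⁻¹ • (c • e + y₀) := by
            rw [smul_add, smul_smul, div_eq_inv_mul]
          rw [this, eq_inv_smul_iff₀ hα, eq_comm]
        simp only [key]
        by_cases h : (x : End F V) (α • e) - y₀ ∈ Submodule.span F {e}
        · obtain ⟨c, hc⟩ := Submodule.mem_span_singleton.1 h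
          rw [if_pos h, Fintype.sum_eq_single c, if_pos hc]
          intro c' hc'
          rw [if_neg]
          intro h'
          exact hc' (smul_left_injective F he (h'.trans hc.symm))
        · rw [if_neg h, Finset.sum_eq_zero]
          intro c _
          rw [if_neg]
          intro h'
          exact h (Submodule.mem_span_singleton.2 ⟨c, h'⟩)
      · intro s _
        rw [if_neg]
        intro h
        apply hm
        rw [Submodule.mem_span_singleton]
        refine ⟨(s : F)⁻¹, ?_⟩
        rw [hy₀, inv_smul_eq_iff₀ s.ne_zero, ← map_smul, ← h, hx']
  · intro y hne
    split_ifs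
    · rfl
    · refine Finset.sum_eq_zero fun c _ => ?_
      rw [if_neg]
      rintro ⟨-, h⟩
      exact hne (hy y h)

/-- The matrix of an automorphism of a plane with basis `e, y` such that `y ↦ e` and
`e ↦ α⁻¹ (c e + y)`. -/
def planeUnit {α : F} (hα : α ≠ 0) (c : F) : (Matrix (Fin 2) (Fin 2) F)ˣ where
  val := !![c / α, 1; α⁻¹, 0]
  inv := !![0, α; 1, -c]
  val_inv := by
    ext i j
    fin_cases i <;> fin_cases j <;> simp [hα]
  inv_val := by
    ext i j
    fin_cases i <;> fin_cases j <;> simp [hα, div_eq_mul_inv]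

/-- Modulo `e`, `N` acts on the line of `y` by a scalar, and a nilpotent scalar is zero. -/
theorem apply_mem_span_singleton_of_mem_span_pair {N : End F V} (hN : IsNilpotent N) {e y : V}
    (hNe : N e = 0) (hli : LinearIndependent F ![e, y]) (hNy : N y ∈ Submodule.span F {e, y}) :
    N y ∈ Submodule.span F {e} := by
  obtain ⟨a, d, had⟩ := Submodule.mem_span_pair.1 hNy
  have hpow : ∀ k, ∃ a' : F, (N ^ k) y = a' • e + d ^ k • y := by
    intro k
    induction k with
    | zero => exact ⟨0, by simp⟩
    | succ k ih =>
      obtain ⟨a', h⟩ := ih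
      refine ⟨d ^ k * a, ?_⟩
      rw [pow_succ', Module.End.mul_apply, h, map_add, map_smul, map_smul, hNe, ← had]
      module
  obtain ⟨k, hk⟩ := hN
  obtain ⟨a', h⟩ := hpow k
  rw [hk, LinearMap.zero_apply] at h
  have hd : d = 0 := by
    have := (LinearIndependent.pair_iff.1 hli a' (d ^ k) h.symm).2
    by_contra hd
    exact pow_ne_zero k hd this
  rw [← had, hd, zero_smul, add_zero]
  exact Submodule.smul_mem _ _ (Submodule.mem_span_singleton_self e)

theorem linearIndependent_pair_of_notMem_span {e y : V} (he : e ≠ 0)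
    (hy : y ∉ Submodule.span F {e}) : LinearIndependent F ![e, y] := by
  rw [LinearIndependent.pair_iff' he]
  intro a ha
  exact hy (Submodule.mem_span_singleton.2 ⟨a, ha⟩)

open scoped Classical in
theorem endKloosterman_scalar_add [Fintype F] [Fintype V] (hχ : χ ≠ 1) {α : F} (hα : α ≠ 0)
    {N : End F V} (hN : IsNilpotent N) {e : V} (he : e ≠ 0) (hNe : N e = 0) (t : V → F)
    (ht : ∀ y, N y ∈ Submodule.span F {e} → N y = t y • e) :
    endKloosterman χ (algebraMap F (End F V) α + N) =
      (Fintype.card F : ℂ) ^ (finrank F V - 1) * (∑ s : Fˣ, χ (α * s + (s : F)⁻¹)) *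
        quotKloosterman χ (algebraMap F (End F V) α + N) (Submodule.span F {e}) +
      (Fintype.card F : ℂ) ^ (2 * (finrank F V - 2) + 1) *
        ∑ y : V, if y ∈ Submodule.span F {e} then 0 else
          χ (t y / α) * quotKloosterman χ (algebraMap F (End F V) α + N)
            (Submodule.span F {e, y}) := by
  have : Finite (End F V) := Finite.of_injective _ DFunLike.coe_injective
  have := Fintype.ofFinite (End F V)ˣ
  set f : End F V := algebraMap F (End F V) α + N with hf
  have hfv : ∀ v, f v = α • v + N v := fun v => by simp [hf]
  rw [endKloosterman_eq_sum_mem_span hχ f e]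
  have hfe : f e = α • e := by rw [hfv, hNe, add_zero]
  simp only [hfe, ite_mem_span_eq he hα, Finset.sum_add_distrib]
  congr 1
  · rw [Finset.sum_comm, Finset.mul_sum, Finset.sum_mul]
    refine Finset.sum_congr rfl fun s _ => ?_
    have h := sum_units_restrict (ι := Unit) hχ (v := fun _ => e)
      (LinearIndependent.of_subsingleton () he) f
      (Units.map (Matrix.scalar Unit).toMonoidHom s) (Matrix.scalar Unit α)
      (fun _ _ => by simp [hfe])
    simp only [Set.range_const, Fintype.card_unit, one_mul, Finset.univ_unique,
      Finset.sum_singleton] at h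
    convert h using 3
    · simp
    · congr 1
      rw [← map_inv]
      simp [Matrix.trace]
  · rw [Finset.sum_comm, Finset.mul_sum]
    refine Finset.sum_congr rfl fun y _ => ?_
    split_ifs with hy
    · simp
    · rw [Finset.sum_comm]
      have hli := linearIndependent_pair_of_notMem_span he hy
      have hr : Set.range ![e, y] = {e, y} := by simp [Set.pair_comm]
      have hc : ∀ c : F, (∑ x : (End F V)ˣ, if (x : End F V) e = (c / α) • e + α⁻¹ • y ∧
          (x : End F V) y = e then
          χ (LinearMap.trace F V (f * (x : End F V) + ((x⁻¹ : (End F V)ˣ) : End F V))) else 0) =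
          (Fintype.card F : ℂ) ^ (2 * (finrank F V - 2)) * χ (t y / α) *
            quotKloosterman χ f (Submodule.span F {e, y}) := by
        intro c
        -- The matrix is that of `f` on a stable plane. The trace is `(c + t y / α) - c`, so `c`
        -- drops out and the sum over `c` contributes one more factor `q`.
        have h := sum_units_restrict hχ hli f (planeUnit hα c) !![α, t y; 0, α] ?_
        · rw [hr] at h
          simp only [Fin.forall_fin_two, Fin.sum_univ_two, Fintype.card_fin] at h
          convert h using 3
          · simp [planeUnit]
          · congr 1
            simp [planeUnit, Matrix.trace_fin_two]
            field_simp
            ring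
        · intro hs
          have hs1 := hs 1
          rw [hr] at hs1
          simp only [Matrix.cons_val_one, Matrix.cons_val_fin_one, hfv] at hs1
          have hNy : N y ∈ Submodule.span F {e, y} := by
            have := Submodule.sub_mem _ hs1
              (Submodule.smul_mem _ α (Submodule.subset_span (Set.mem_insert_of_mem e rfl)))
            simpa using this
          have hNy' := apply_mem_span_singleton_of_mem_span_pair hN hNe hli hNy
          intro i
          fin_cases i
          · simp [hfe]
          · simp [hfv, ht y hNy', add_comm]
      rw [Finset.sum_congr rfl fun c _ => hc c]
      simp only [Finset.sum_const, Finset.card_univ, nsmul_eq_mul]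
      ring

end Recursion

/-! ### Conjugacy of kernel vectors under the centralizer -/

section Centralizer

variable {F : Type*} [Field F] {V : Type*} [AddCommGroup V] [Module F V]

/-- One of `ψ₁`, `ψ₂`, `ψ₁ + ψ₂` is nonzero at both vectors; this works over every field, including
the one with two elements. -/
theorem exists_dual_apply_eq_one_and_ne_zero {p : Submodule F V} {z₁ z₂ : V} (h₁ : z₁ ∉ p)
    (h₂ : z₂ ∉ p) : ∃ ψ : Dual F V, ψ z₁ = 1 ∧ ψ z₂ ≠ 0 ∧ p ≤ LinearMap.ker ψ := by
  suffices ∃ ψ : Dual F V, ψ z₁ ≠ 0 ∧ ψ z₂ ≠ 0 ∧ p ≤ LinearMap.ker ψ by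
    obtain ⟨ψ, h1, h2, h3⟩ := this
    refine ⟨(ψ z₁)⁻¹ • ψ, by simp [h1], by simp [h1, h2], fun v hv => ?_⟩
    have := LinearMap.mem_ker.1 (h3 hv)
    simp [this]
  obtain ⟨ψ₁, h11, h1p⟩ := p.exists_le_ker_of_notMem h₁
  obtain ⟨ψ₂, h22, h2p⟩ := p.exists_le_ker_of_notMem h₂
  by_cases h12 : ψ₁ z₂ = 0
  · by_cases h21 : ψ₂ z₁ = 0
    · refine ⟨ψ₁ + ψ₂, by simpa [h21], by simpa [h12], fun v hv => ?_⟩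
      have a := LinearMap.mem_ker.1 (h1p hv)
      have b := LinearMap.mem_ker.1 (h2p hv)
      simp [a, b]
    · exact ⟨ψ₂, h21, h22, h2p⟩
  · exact ⟨ψ₁, h11, h12, h1p⟩

/-- Two kernel vectors of a nilpotent endomorphism `N` of the same height are conjugate under the
centralizer of `N`. -/
theorem exists_equiv_commute_apply_eq [Module.Finite F V] {N : End F V} (hN : IsNilpotent N)
    {h : ℕ} {z₁ z₂ : V} (hz₁ : N z₁ = 0) (hz₂ : N z₂ = 0)
    (h₁ : z₁ ∈ LinearMap.range (N ^ h)) (h₂ : z₂ ∈ LinearMap.range (N ^ h))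
    (h₁' : z₁ ∉ LinearMap.range (N ^ (h + 1))) (h₂' : z₂ ∉ LinearMap.range (N ^ (h + 1))) :
    ∃ g : V ≃ₗ[F] V, (∀ v, g (N v) = N (g v)) ∧ g z₁ = z₂ := by
  obtain ⟨w, hw⟩ := Submodule.sub_mem _ h₂ h₁
  obtain ⟨ψ, hψ₁, hψ₂, hψ⟩ := exists_dual_apply_eq_one_and_ne_zero h₁' h₂'
  have hψ' : ∀ v, ψ ((N ^ (h + 1)) v) = 0 := fun v => LinearMap.mem_ker.1 (hψ ⟨v, rfl⟩)
  have hw' : (N ^ (h + 1)) w = 0 := by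
    rw [pow_succ', Module.End.mul_apply, hw, map_sub, hz₁, hz₂, sub_zero]
  -- `T` commutes with `N` because the sum shifts by one index and its end terms die: `ψ N^(h+1) =
  -- 0` and `N^(h+1) w = 0`. On `ker N` only `i = 0` survives, so `T` is `ψ(·) (z₂ - z₁)` there and
  -- `1 + T` sends `z₁` to `z₂`.
  let T : End F V := ∑ i ∈ Finset.range (h + 1), (ψ ∘ₗ (N ^ i)).smulRight ((N ^ (h - i)) w)
  have hT : ∀ v, T v = ∑ i ∈ Finset.range (h + 1), ψ ((N ^ i) v) • (N ^ (h - i)) w := fun v => by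
    simp [T, LinearMap.sum_apply]
  have hTN : ∀ v, T (N v) = N (T v) := by
    intro v
    rw [hT, hT, map_sum, Finset.sum_range_succ, Finset.sum_range_succ']
    simp only [← Module.End.mul_apply, ← pow_succ, hψ', zero_smul, add_zero, map_smul, ← pow_succ',
      Nat.sub_zero, hw', smul_zero]
    refine Finset.sum_congr rfl fun i hi => ?_
    rw [show h - (i + 1) + 1 = h - i by have := Finset.mem_range.1 hi; lia]
  have hTk : ∀ v, N v = 0 → T v = ψ v • (z₂ - z₁) := by
    intro v hv
    rw [hT, Finset.sum_range_succ', Finset.sum_eq_zero, zero_add, pow_zero, Nat.sub_zero, hw]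
    · rfl
    · intro i _
      rw [pow_succ, Module.End.mul_apply, hv, map_zero, map_zero, zero_smul]
  -- The kernel of `1 + T` is `N`-stable, so it suffices to look at `ker N`. There, applying `ψ` to
  -- `v + T v = 0` gives `ψ v * ψ z₂ = 0`.
  have hinj : ∀ k v, (N ^ k) v = 0 → v + T v = 0 → v = 0 := by
    intro k
    induction k with
    | zero => intro v hv _; simpa using hv
    | succ k ih =>
      intro v hv hg
      have hNv : N v = 0 := by
        refine ih _ (by rw [← Module.End.mul_apply, ← pow_succ, hv]) ?_
        rw [hTN, ← map_add, hg, map_zero]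
      rw [hTk v hNv] at hg
      have h0 := congrArg ψ hg
      rw [map_add, map_smul, map_sub, hψ₁, map_zero, smul_eq_mul] at h0
      have h1 : ψ v = 0 := by
        have : ψ v * ψ z₂ = 0 := by rw [← h0]; ring
        simpa [hψ₂] using this
      simpa [h1] using hg
  obtain ⟨k, hk⟩ := hN
  have hinj' : Function.Injective (1 + T : End F V) := by
    rw [← LinearMap.ker_eq_bot, LinearMap.ker_eq_bot']
    intro v hv
    exact hinj k v (by rw [hk, LinearMap.zero_apply]) hv
  refine ⟨LinearEquiv.ofInjectiveEndo (1 + T) hinj', fun v => ?_, ?_⟩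
  · simp [hTN]
  · simp [hTk z₁ hz₁, hψ₁]

variable (χ : AddChar F ℂ)

/-- Modulo `e` both `z₁` and `z₂` are kernel vectors of height exactly `h`, hence conjugate by an
automorphism commuting with the induced map; it carries one quotient to the other. -/
theorem quotKloosterman_pair_congr [Module.Finite F V] {N : End F V} (hN : IsNilpotent N) (α : F)
    {e : V} (he : N e = 0) {h : ℕ} {z₁ z₂ : V}
    (hz₁ : N z₁ ∈ Submodule.span F {e}) (hz₂ : N z₂ ∈ Submodule.span F {e})
    (h₁ : z₁ ∈ LinearMap.range (N ^ h)) (h₂ : z₂ ∈ LinearMap.range (N ^ h))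
    (h₁' : ∀ v (c : F), z₁ ≠ (N ^ (h + 1)) v + c • e)
    (h₂' : ∀ v (c : F), z₂ ≠ (N ^ (h + 1)) v + c • e) :
    quotKloosterman χ (algebraMap F (End F V) α + N) (Submodule.span F {e, z₁}) =
      quotKloosterman χ (algebraMap F (End F V) α + N) (Submodule.span F {e, z₂}) := by
  set E := Submodule.span F {e} with hE
  have hst : E ≤ E.comap N := by
    rw [hE, Submodule.span_singleton_le_iff_mem, Submodule.mem_comap, he]
    exact Submodule.zero_mem _
  set M : End F (V ⧸ E) := E.mapQ E N hst with hM
  have hMπ : ∀ v, M (E.mkQ v) = E.mkQ (N v) := fun v => rfl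
  have hMpow : ∀ k v, (M ^ k) (E.mkQ v) = E.mkQ ((N ^ k) v) := by
    intro k
    induction k with
    | zero => intro v; rfl
    | succ k ih => intro v; rw [pow_succ, pow_succ, Module.End.mul_apply, Module.End.mul_apply,
        hMπ, ih]
  have hMnil : IsNilpotent M := by
    obtain ⟨k, hk⟩ := hN
    refine ⟨k, LinearMap.ext fun v => ?_⟩
    obtain ⟨v, rfl⟩ := E.mkQ_surjective v
    rw [hMpow, hk]
    simp
  have hker : ∀ z, N z ∈ E → M (E.mkQ z) = 0 := fun z hz => by
    rw [hMπ]
    simpa using hz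
  have hrange : ∀ k z, z ∈ LinearMap.range (N ^ k) → E.mkQ z ∈ LinearMap.range (M ^ k) := by
    rintro k _ ⟨v, rfl⟩
    exact ⟨E.mkQ v, hMpow k v⟩
  have hrange' : ∀ k z, (∀ v (c : F), z ≠ (N ^ k) v + c • e) →
      E.mkQ z ∉ LinearMap.range (M ^ k) := by
    rintro k z hz ⟨v, hv⟩
    obtain ⟨v, rfl⟩ := E.mkQ_surjective v
    rw [hMpow, eq_comm, ← sub_eq_zero, ← map_sub, ← LinearMap.mem_ker, Submodule.ker_mkQ] at hv
    obtain ⟨c, hc⟩ := Submodule.mem_span_singleton.1 hv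
    exact hz v c (by rw [hc]; abel)
  obtain ⟨g, hg, hgz⟩ := exists_equiv_commute_apply_eq hMnil (hker _ hz₁) (hker _ hz₂)
    (hrange _ _ h₁) (hrange _ _ h₂) (hrange' _ _ h₁') (hrange' _ _ h₂')
  have hstab : ∀ z, N z ∈ E → Submodule.span F {E.mkQ z} ≤
      (Submodule.span F {E.mkQ z}).comap (algebraMap F (End F (V ⧸ E)) α + M) := by
    intro z hz
    rw [Submodule.span_singleton_le_iff_mem, Submodule.mem_comap, LinearMap.add_apply, hker z hz,
      add_zero]
    exact Submodule.smul_mem _ α (Submodule.mem_span_singleton_self _)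
  have hquot : ∀ z, N z ∈ E →
      quotKloosterman χ (algebraMap F (End F V) α + N) (Submodule.span F {e, z}) =
      quotKloosterman χ (algebraMap F (End F (V ⧸ E)) α + M) (Submodule.span F {E.mkQ z}) := by
    intro z hz
    rw [← quotKloosterman_comap χ (f := algebraMap F (End F V) α + N) E.mkQ E.mkQ_surjective
      (fun v => by simp [hM]) _ (hstab z hz)]
    congr 1
    rw [← Set.image_singleton, ← Submodule.map_span, Submodule.comap_map_eq, Submodule.ker_mkQ,
      hE, sup_comm, ← Submodule.span_union]
    rfl
  rw [hquot z₁ hz₁, hquot z₂ hz₂, ← quotKloosterman_comap χ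
    (f := algebraMap F (End F (V ⧸ E)) α + M) g.toLinearMap g.surjective
    (fun v => by simp [hg]) _ (hstab z₂ hz₂)]
  congr 1
  ext v
  simp only [Submodule.mem_span_singleton, Submodule.mem_comap, ← hgz, LinearEquiv.coe_coe,
    ← map_smul, EmbeddingLike.apply_eq_iff_eq]

end Centralizer

/-! ### Evaluating the sum over planes by heights -/

section Heights

variable {F : Type*} [Field F] {χ : AddChar F ℂ} {V : Type*} [AddCommGroup V] [Module F V]

theorem quotKloosterman_pair_smul (f : End F V) (e z : V) {s : F} (hs : s ≠ 0) :
    quotKloosterman χ f (Submodule.span F {e, s • z}) =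
      quotKloosterman χ f (Submodule.span F {e, z}) := by
  rw [Submodule.span_insert, Submodule.span_insert,
    Submodule.span_singleton_smul_eq (IsUnit.mk0 s hs)]

open scoped Classical in
/-- The sum over the planes containing `e`, in terms of a preimage `y₀` of `e` and the kernel. -/
theorem sum_pairs_eq_sum_ker [Fintype F] [Fintype V] (hχ : χ ≠ 1) {α : F} (hα : α ≠ 0)
    {N : End F V} (hN : IsNilpotent N) {e y₀ : V} (he : e ≠ 0) (hNe : N e = 0) (hy₀ : N y₀ = e)
    {t : V → F} (ht : ∀ y, N y ∈ Submodule.span F {e} → N y = t y • e) :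
    (∑ y : V, if y ∈ Submodule.span F {e} then 0 else
      χ (t y / α) * quotKloosterman χ (algebraMap F (End F V) α + N) (Submodule.span F {e, y})) =
    ∑ z : LinearMap.ker N,
      ((if (z : V) ∈ Submodule.span F {e} then 0 else
        quotKloosterman χ (algebraMap F (End F V) α + N) (Submodule.span F {e, (z : V)})) -
      quotKloosterman χ (algebraMap F (End F V) α + N) (Submodule.span F {e, y₀ + z})) := by
  set κ : V → ℂ := fun y =>
    quotKloosterman χ (algebraMap F (End F V) α + N) (Submodule.span F {e, y}) with hκ
  set G : V → ℂ := fun y => if y ∈ Submodule.span F {e} then 0 else χ (t y / α) * κ y with hG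
  have hNsz : ∀ (s : F) (z : LinearMap.ker N), N (s • y₀ + z) = s • e := fun s z => by
    rw [map_add, map_smul, hy₀, LinearMap.mem_ker.1 z.2, add_zero]
  have hmem : ∀ (s : F), s • e ∈ Submodule.span F {e} := fun s =>
    Submodule.smul_mem _ _ (Submodule.mem_span_singleton_self e)
  have htsz : ∀ (s : F) (z : LinearMap.ker N), t (s • y₀ + z) = s := fun s z => by
    have h := ht (s • y₀ + z) (by rw [hNsz]; exact hmem s)
    rw [hNsz] at h
    exact (smul_left_injective F he h).symm
  -- Only `y` with `N y ∈ ⟨e⟩` span a stable plane with `e`; these are the vectors `s y₀ + z`, and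
  -- `t` takes the value `s` on them.
  have h1 : ∑ y, G y = ∑ x : F × LinearMap.ker N, G (x.1 • y₀ + x.2) := by
    symm
    refine Fintype.sum_of_injective (fun x : F × LinearMap.ker N => x.1 • y₀ + (x.2 : V)) ?_ _ _ ?_
      fun _ => rfl
    · rintro ⟨s, z⟩ ⟨s', z'⟩ h
      have h2 := congrArg N h
      simp only [hNsz] at h2
      have h3 : s = s' := smul_left_injective F he h2
      subst h3
      simpa using h
    · intro y hy
      simp only [hG]
      split_ifs with hye
      · rfl
      · rw [hκ]
        simp only
        rw [quotKloosterman, dif_neg, mul_zero]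
        intro hst
        have hy' : (algebraMap F (End F V) α + N) y ∈ Submodule.span F {e, y} :=
          hst (Submodule.subset_span (Set.mem_insert_of_mem e rfl))
        have hNy : N y ∈ Submodule.span F {e, y} := by
          have := Submodule.sub_mem _ hy'
            (Submodule.smul_mem _ α (Submodule.subset_span (Set.mem_insert_of_mem e rfl)))
          simpa using this
        have hNy' := ht y (apply_mem_span_singleton_of_mem_span_pair hN hNe
          (linearIndependent_pair_of_notMem_span he hye) hNy)
        exact hy ⟨(t y, ⟨y - t y • y₀, by simp [hNy', hy₀]⟩), by simp⟩
  have h0 : ∀ z : LinearMap.ker N,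
      G ((0 : F) • y₀ + z) = if (z : V) ∈ Submodule.span F {e} then 0 else κ z := by
    intro z
    simp only [hG, htsz]
    simp
  have h2 : ∀ (s : Fˣ), ∑ z : LinearMap.ker N, G ((s : F) • y₀ + z) =
      χ ((s : F) / α) * ∑ z : LinearMap.ker N, κ (y₀ + z) := by
    intro s
    -- Replacing `z` by `s z` makes the plane `⟨e, s (y₀ + z)⟩`, which does not depend on `s`.
    rw [← Equiv.sum_comp (LinearEquiv.smulOfUnit s).toEquiv, Finset.mul_sum]
    refine Finset.sum_congr rfl fun z _ => ?_
    have hz : (((LinearEquiv.smulOfUnit s).toEquiv z : LinearMap.ker N) : V) = (s : F) • (z : V) :=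
      rfl
    have hn : (s : F) • y₀ + (((LinearEquiv.smulOfUnit s).toEquiv z : LinearMap.ker N) : V) ∉
        Submodule.span F {e} := by
      intro h
      obtain ⟨c, hc⟩ := Submodule.mem_span_singleton.1 h
      have h3 := congrArg N hc
      rw [hNsz, map_smul, hNe, smul_zero, eq_comm, smul_eq_zero] at h3
      exact h3.elim s.ne_zero he
    simp only [hG]
    rw [if_neg hn, htsz, hz, ← smul_add]
    simp only [hκ]
    rw [quotKloosterman_pair_smul _ _ _ s.ne_zero]
  rw [h1, Fintype.sum_prod_type, sum_eq_add_sum_units, Finset.sum_congr rfl fun s _ => h2 s,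
    ← Finset.sum_mul, sum_addChar_div_units hχ hα, Finset.sum_sub_distrib,
    Finset.sum_congr rfl fun z _ => h0 z]
  ring

open scoped Classical in
-- Kernel vectors outside the range of `N^(m+1)` cancel against their translates by `y₀`. On that
-- range `κ` takes one value off `⟨e⟩`, and is constant on the translate by `y₀`, so only
-- cardinalities remain.
theorem endKloosterman_recursion [Fintype F] [Finite V] (hχ : χ ≠ 1) {α : F} (hα : α ≠ 0)
    {N : End F V} {m : ℕ} (hNm : N ^ (m + 2) = 0) {f₀ e₂ : V} (he : (N ^ (m + 1)) f₀ ≠ 0)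
    (he₂ : e₂ ∈ LinearMap.range (N ^ (m + 1)))
    (he₂' : e₂ ∉ Submodule.span F {(N ^ (m + 1)) f₀}) :
    endKloosterman χ (algebraMap F (End F V) α + N) =
      (Fintype.card F : ℂ) ^ (finrank F V - 1) * (∑ s : Fˣ, χ (α * s + (s : F)⁻¹)) *
        quotKloosterman χ (algebraMap F (End F V) α + N) (Submodule.span F {(N ^ (m + 1)) f₀}) +
      (Fintype.card F : ℂ) ^ (2 * (finrank F V - 2) + 1) *
        (((Nat.card (LinearMap.range (N ^ (m + 1))) : ℂ) - Fintype.card F) *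
          quotKloosterman χ (algebraMap F (End F V) α + N)
            (Submodule.span F {(N ^ (m + 1)) f₀, e₂}) -
        (Nat.card (LinearMap.range (N ^ (m + 1))) : ℂ) *
          quotKloosterman χ (algebraMap F (End F V) α + N)
            (Submodule.span F {(N ^ (m + 1)) f₀, (N ^ m) f₀})) := by
  have := Fintype.ofFinite V
  have hN : IsNilpotent N := ⟨_, hNm⟩
  set y₀ := (N ^ m) f₀ with hy₀
  set e := (N ^ (m + 1)) f₀ with hedef
  set R := LinearMap.range (N ^ (m + 1)) with hR
  have hNe : N e = 0 := by
    rw [hedef, ← Module.End.mul_apply, ← pow_succ', hNm, LinearMap.zero_apply]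
  have hNy : N y₀ = e := by rw [hedef, hy₀, ← Module.End.mul_apply, ← pow_succ']
  have hNR : ∀ v, N ((N ^ (m + 1)) v) = 0 := fun v => by
    rw [← Module.End.mul_apply, ← pow_succ', hNm, LinearMap.zero_apply]
  have hRker : R ≤ LinearMap.ker N := by
    rintro _ ⟨v, rfl⟩
    exact hNR v
  have heR : e ∈ R := ⟨f₀, rfl⟩
  have heE : e ∈ Submodule.span F {e} := Submodule.mem_span_singleton_self e
  have hER : Submodule.span F {e} ≤ R := by
    rwa [Submodule.span_singleton_le_iff_mem]
  have hmono : ∀ {i j : ℕ}, i ≤ j → LinearMap.range (N ^ j) ≤ LinearMap.range (N ^ i) := by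
    rintro i j hij _ ⟨v, rfl⟩
    exact ⟨(N ^ (j - i)) v, by rw [← Module.End.mul_apply, ← pow_add, Nat.add_sub_cancel' hij]⟩
  have hkerE : ∀ z ∈ LinearMap.ker N, N z ∈ Submodule.span F {e} := fun z hz => by
    rw [LinearMap.mem_ker.1 hz]
    exact Submodule.zero_mem _
  have hy₀E : ∀ z ∈ LinearMap.ker N, N (y₀ + z) ∈ Submodule.span F {e} := fun z hz => by
    rw [map_add, hNy, LinearMap.mem_ker.1 hz, add_zero]
    exact heE
  have hy₀m : y₀ ∈ LinearMap.range (N ^ m) := ⟨f₀, rfl⟩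
  have hy₀R : ∀ z ∈ LinearMap.ker N, ∀ v (c : F), y₀ + z ≠ (N ^ (m + 1)) v + c • e := by
    intro z hz v c h
    have h1 := congrArg N h
    rw [map_add, map_add, hNy, LinearMap.mem_ker.1 hz, hNR, map_smul, hNe, smul_zero, add_zero,
      add_zero] at h1
    exact he h1
  choose t ht using fun y (h : N y ∈ Submodule.span F {e}) => Submodule.mem_span_singleton.1 h
  let t' : V → F := fun y => if h : N y ∈ Submodule.span F {e} then t y h else 0
  have ht' : ∀ y, N y ∈ Submodule.span F {e} → N y = t' y • e := by
    intro y hy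
    simp only [t', dif_pos hy, ht]
  rw [endKloosterman_scalar_add hχ hα hN he hNe t' ht',
    sum_pairs_eq_sum_ker hχ hα hN he hNe hNy ht']
  congr 2
  set κ : V → ℂ := fun y =>
    quotKloosterman χ (algebraMap F (End F V) α + N) (Submodule.span F {e, y}) with hκ
  change ∑ z : LinearMap.ker N,
    ((if (z : V) ∈ Submodule.span F {e} then 0 else κ z) - κ (y₀ + z)) =
      ((Nat.card R : ℂ) - Fintype.card F) * κ e₂ - (Nat.card R : ℂ) * κ y₀
  -- Let `h ≤ m` be the height of `z`. If `h < m`, adding `y₀`, which lies in the range of `N^m`,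
  -- does not change the height; if `h = m`, then `N (y₀ + z) = e ≠ 0` keeps `y₀ + z` out of the
  -- range of `N^(m+1)`, even modulo `e`.
  have hcancel : ∀ z ∈ LinearMap.ker N, z ∉ R → κ z = κ (y₀ + z) := by
    intro z hz hzR
    have hex : ∃ h, z ∉ LinearMap.range (N ^ (h + 1)) := ⟨m, hzR⟩
    set h := Nat.find hex with hh
    have hm : h ≤ m := Nat.find_min' hex hzR
    have hz1 : z ∉ LinearMap.range (N ^ (h + 1)) := Nat.find_spec hex
    have hz0 : z ∈ LinearMap.range (N ^ h) := by
      rcases Nat.eq_zero_or_pos h with h0 | h0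
      · rw [h0]
        exact ⟨z, rfl⟩
      · have := Nat.find_min hex (m := h - 1) (by lia)
        rw [not_not, Nat.sub_add_cancel h0] at this
        exact this
    have hsum : ∀ v (c : F), (N ^ (h + 1)) v + c • e ∈ LinearMap.range (N ^ (h + 1)) :=
      fun v c => Submodule.add_mem _ ⟨v, rfl⟩
        (Submodule.smul_mem _ _ (hmono (by lia) heR))
    refine quotKloosterman_pair_congr χ hN α hNe (h := h) (hkerE z hz) (hy₀E z hz) hz0
      (Submodule.add_mem _ (hmono hm hy₀m) hz0) ?_ ?_
    · intro v c hv
      exact hz1 (hv ▸ hsum v c)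
    · rcases hm.lt_or_eq with hlt | heq
      · intro v c hv
        apply hz1
        have h1 := hsum v c
        rw [← hv] at h1
        simpa using Submodule.sub_mem _ h1 (hmono (show h + 1 ≤ m by lia) hy₀m)
      · rw [heq]
        exact hy₀R z hz
  have hy₀κ : ∀ z ∈ R, κ (y₀ + z) = κ y₀ := by
    intro z hz
    have h0 := hy₀R 0 (Submodule.zero_mem _)
    have h1 := hy₀E 0 (Submodule.zero_mem _)
    rw [add_zero] at h0 h1
    exact quotKloosterman_pair_congr χ hN α hNe (h := m) (hy₀E z (hRker hz)) h1
      (Submodule.add_mem _ hy₀m (hmono (Nat.le_succ m) hz)) hy₀m (hy₀R z (hRker hz)) h0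
  -- These vectors have the top height `m + 1`: since `N^(m+2) = 0`, the upper bound on the height
  -- says only that they lie outside `⟨e⟩`.
  have hzκ : ∀ z ∈ R, z ∉ Submodule.span F {e} → κ z = κ e₂ := by
    intro z hz hzE
    have hne : ∀ y, y ∉ Submodule.span F {e} →
        ∀ v (c : F), y ≠ (N ^ (m + 1 + 1)) v + c • e := by
      intro y hy v c h
      apply hy
      rw [h, hNm, LinearMap.zero_apply, zero_add]
      exact Submodule.smul_mem _ _ heE
    exact quotKloosterman_pair_congr χ hN α hNe (h := m + 1) (hkerE z (hRker hz))
      (hkerE e₂ (hRker he₂)) hz he₂ (hne z hzE) (hne e₂ he₂')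
  rw [← Fintype.sum_of_injective (Submodule.inclusion hRker) (Submodule.inclusion_injective hRker)
    (fun z : R => (κ e₂ - if (z : V) ∈ Submodule.span F {e} then κ e₂ else 0) - κ y₀)]
  · have hcount : (∑ z : R, if (z : V) ∈ Submodule.span F {e} then κ e₂ else 0) =
        ∑ _c : F, κ e₂ := by
      symm
      refine Fintype.sum_of_injective
        (fun c : F => (⟨c • e, Submodule.smul_mem _ _ heR⟩ : R)) (fun c c' h => ?_) _ _ ?_ ?_
      · exact smul_left_injective F he (congrArg Subtype.val h)
      · intro z hz
        rw [if_neg]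
        intro h
        obtain ⟨c, hc⟩ := Submodule.mem_span_singleton.1 h
        exact hz ⟨c, Subtype.ext hc⟩
      · intro c
        rw [if_pos (Submodule.smul_mem _ _ heE)]
    rw [Finset.sum_sub_distrib, Finset.sum_sub_distrib, hcount]
    simp only [Finset.sum_const, Finset.card_univ, nsmul_eq_mul, Nat.card_eq_fintype_card]
    ring
  · intro z hz
    have hzR : (z : V) ∉ R := fun h => hz ⟨⟨z, h⟩, rfl⟩
    rw [if_neg fun h => hzR (hER h), hcancel z z.2 hzR, sub_self]
  · intro z
    rw [Submodule.coe_inclusion, hy₀κ z z.2]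
    split_ifs with h
    · simp
    · rw [hzκ z z.2 h, sub_zero]

end Heights

/-! ### A coordinate model of nilpotent Jordan blocks -/

section JordanModel

variable (F : Type*) [Field F] {I : Type*}

/-- A model for a sum of nilpotent Jordan blocks of sizes `d i`: the `i`-th block consists of
sequences supported on `[0, d i)`. -/
def jordanSpace (d : I → ℕ) : Submodule F (I → ℕ → F) where
  -- Sequences on all of `ℕ` avoid types depending on `d`, so block sizes can be updated freely;
  -- size `0` is allowed.
  carrier := {v | ∀ i j, d i ≤ j → v i j = 0}
  add_mem' hv hw i j h := by simp [hv i j h, hw i j h]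
  zero_mem' _ _ _ := rfl
  smul_mem' c v hv i j h := by simp [hv i j h]

instance jordanSpace_finite [Finite F] [Finite I] (d : I → ℕ) : Finite (jordanSpace F d) := by
  refine Finite.of_injective (fun v (i : I) (j : Fin (d i)) => (v : I → ℕ → F) i j) fun v w h => ?_
  ext i j
  by_cases hj : j < d i
  · exact congrFun (congrFun h i) ⟨j, hj⟩
  · rw [v.2 i j (not_lt.1 hj), w.2 i j (not_lt.1 hj)]

/-- The nilpotent shift on `jordanSpace F d`. -/
def jordanShift (d : I → ℕ) : End F (jordanSpace F d) where
  toFun v := ⟨fun i j => (v : I → ℕ → F) i (j + 1), fun i j h => v.2 i _ (by lia)⟩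
  map_add' _ _ := rfl
  map_smul' _ _ := rfl

variable {F}

theorem jordanShift_apply (d : I → ℕ) (v : jordanSpace F d) (i : I) (j : ℕ) :
    (jordanShift F d v : I → ℕ → F) i j = (v : I → ℕ → F) i (j + 1) := rfl

theorem jordanShift_pow_apply (d : I → ℕ) (k : ℕ) (v : jordanSpace F d) (i : I) (j : ℕ) :
    ((jordanShift F d ^ k) v : I → ℕ → F) i j = (v : I → ℕ → F) i (j + k) := by
  induction k generalizing v with
  | zero => rfl
  | succ k ih =>
    rw [pow_succ, Module.End.mul_apply, ih, jordanShift_apply]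
    rfl

theorem jordanShift_pow_eq_zero {d : I → ℕ} {m : ℕ} (hd : ∀ i, d i ≤ m) :
    jordanShift F d ^ m = 0 := by
  ext v i j
  rw [jordanShift_pow_apply]
  exact v.2 i _ ((hd i).trans (Nat.le_add_left m j))

section Vec

variable [DecidableEq I]

variable (F) in
/-- The basis vector of `jordanSpace F d` at position `j` of the block `i`. -/
def jordanVec {d : I → ℕ} (i : I) (j : ℕ) (h : j < d i) : jordanSpace F d :=
  ⟨fun i' j' => if i' = i ∧ j' = j then 1 else 0, fun i' j' h' => by
    refine if_neg ?_
    rintro ⟨rfl, rfl⟩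
    lia⟩

theorem jordanVec_apply {d : I → ℕ} (i : I) (j : ℕ) (h : j < d i) (i' : I) (j' : ℕ) :
    (jordanVec F i j h : I → ℕ → F) i' j' = if i' = i ∧ j' = j then 1 else 0 := rfl

theorem jordanShift_pow_jordanVec {d : I → ℕ} (k : ℕ) (i : I) {j l : ℕ} (hl : l < d i)
    (h : j + k = l) :
    (jordanShift F d ^ k) (jordanVec F i l hl) = jordanVec F i j (by lia) := by
  subst h
  ext i' j'
  rw [jordanShift_pow_apply, jordanVec_apply, jordanVec_apply]
  simp

theorem jordanVec_ne_zero {d : I → ℕ} (i : I) (j : ℕ) (h : j < d i) : jordanVec F i j h ≠ 0 := by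
  intro h0
  have := congrArg (fun v : jordanSpace F d => (v : I → ℕ → F) i j) h0
  simp [jordanVec_apply] at this

theorem jordanVec_notMem_span {d : I → ℕ} {i i' : I} (hi : i ≠ i') {j j' : ℕ} (h : j < d i)
    (h' : j' < d i') :
    jordanVec F i j h ∉ Submodule.span F {jordanVec F i' j' h'} := by
  intro hm
  obtain ⟨c, hc⟩ := Submodule.mem_span_singleton.1 hm
  have := congrArg (fun v : jordanSpace F d => (v : I → ℕ → F) i j) hc
  simp [jordanVec_apply, hi] at this

variable (F) in
/-- Removing the first coordinate of the block `i₀`. -/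
def jordanDrop (d : I → ℕ) (i₀ : I) (x : ℕ) (hx : d i₀ ≤ x + 1) :
    jordanSpace F d →ₗ[F] jordanSpace F (Function.update d i₀ x) where
  toFun v := ⟨fun i j => if i = i₀ then (v : I → ℕ → F) i (j + 1) else (v : I → ℕ → F) i j, by
    intro i j h
    rcases eq_or_ne i i₀ with rfl | hi
    · rw [Function.update_self] at h
      exact (if_pos rfl).trans (v.2 _ _ (by lia))
    · rw [Function.update_of_ne hi] at h
      exact (if_neg hi).trans (v.2 _ _ h)⟩
  map_add' v w := by
    ext i j
    by_cases h : i = i₀ <;> simp [h]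
  map_smul' c v := by
    ext i j
    by_cases h : i = i₀ <;> simp [h]

theorem jordanDrop_apply (d : I → ℕ) (i₀ : I) (x : ℕ) (hx : d i₀ ≤ x + 1) (v : jordanSpace F d)
    (i : I) (j : ℕ) : (jordanDrop F d i₀ x hx v : I → ℕ → F) i j =
      if i = i₀ then (v : I → ℕ → F) i (j + 1) else (v : I → ℕ → F) i j := rfl

theorem jordanDrop_jordanVec_self {d : I → ℕ} (i₀ : I) (x : ℕ) (hx : d i₀ ≤ x + 1) (j : ℕ)
    (h : j + 1 < d i₀) :
    jordanDrop F d i₀ x hx (jordanVec F i₀ (j + 1) h) =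
      jordanVec F i₀ j (by rw [Function.update_self]; lia) := by
  ext i' j'
  rw [jordanDrop_apply, jordanVec_apply, jordanVec_apply, jordanVec_apply]
  by_cases hi : i' = i₀ <;> simp [hi]

theorem jordanDrop_jordanVec_of_ne {d : I → ℕ} {i₀ i : I} (hne : i ≠ i₀) (x : ℕ)
    (hx : d i₀ ≤ x + 1) (j : ℕ) (h : j < d i) :
    jordanDrop F d i₀ x hx (jordanVec F i j h) =
      jordanVec F i j (by rwa [Function.update_of_ne hne]) := by
  ext i' j'
  rw [jordanDrop_apply, jordanVec_apply, jordanVec_apply, jordanVec_apply]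
  by_cases hi : i' = i₀
  · simp [hi, hne.symm]
  · simp [hi]

theorem jordanDrop_surjective (d : I → ℕ) (i₀ : I) (x : ℕ) (hx : d i₀ = x + 1) :
    Function.Surjective (jordanDrop F d i₀ x hx.le) := by
  intro w
  refine ⟨⟨fun i j => if i = i₀ then (if j = 0 then 0 else (w : I → ℕ → F) i (j - 1)) else
    (w : I → ℕ → F) i j, ?_⟩, ?_⟩
  · intro i j h
    rcases eq_or_ne i i₀ with rfl | hi
    · exact (if_pos rfl).trans ((if_neg (by lia)).trans
        (w.2 _ _ (by rw [Function.update_self]; lia)))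
    · exact (if_neg hi).trans (w.2 _ _ (by rwa [Function.update_of_ne hi]))
  · ext i j
    rw [jordanDrop_apply]
    by_cases h : i = i₀ <;> simp [h]

theorem ker_jordanDrop (d : I → ℕ) (i₀ : I) (x : ℕ) (hx : d i₀ = x + 1) :
    LinearMap.ker (jordanDrop F d i₀ x hx.le) =
      Submodule.span F {jordanVec F i₀ 0 (by lia)} := by
  ext v
  rw [LinearMap.mem_ker, Submodule.mem_span_singleton]
  constructor
  · intro h
    have hv : ∀ i j, (if i = i₀ then (v : I → ℕ → F) i (j + 1) else (v : I → ℕ → F) i j) = 0 :=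
      fun i j => congrFun (congrFun (congrArg Subtype.val h) i) j
    refine ⟨(v : I → ℕ → F) i₀ 0, ?_⟩
    ext i j
    change _ * (if i = i₀ ∧ j = 0 then (1 : F) else 0) = _
    rcases eq_or_ne i i₀ with rfl | hi
    · rcases j with _ | j
      · simp
      · simpa using (hv i j).symm
    · simpa [hi] using (hv i j).symm
  · rintro ⟨c, rfl⟩
    ext i j
    rw [jordanDrop_apply]
    change (if i = i₀ then c * (if i = i₀ ∧ j + 1 = 0 then (1 : F) else 0) else
      c * (if i = i₀ ∧ j = 0 then (1 : F) else 0)) = 0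
    split_ifs <;> simp_all

theorem jordanDrop_jordanShift (d : I → ℕ) (i₀ : I) (x : ℕ) (hx : d i₀ ≤ x + 1)
    (v : jordanSpace F d) :
    jordanDrop F d i₀ x hx (jordanShift F d v) =
      jordanShift F (Function.update d i₀ x) (jordanDrop F d i₀ x hx v) := rfl

variable (χ : AddChar F ℂ) (α : F)

theorem quotKloosterman_jordanVec (d : I → ℕ) (i₀ : I) (x : ℕ) (hx : d i₀ = x + 1) :
    quotKloosterman χ (algebraMap F _ α + jordanShift F d)
      (Submodule.span F {jordanVec F i₀ 0 (by lia)}) =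
    endKloosterman χ (algebraMap F _ α + jordanShift F (Function.update d i₀ x)) := by
  refine quotKloosterman_eq χ (jordanDrop F d i₀ x hx.le) (jordanDrop_surjective d i₀ x hx)
    (ker_jordanDrop d i₀ x hx) fun v => ?_
  simp [jordanDrop_jordanShift]

/-- After the first quotient `z` becomes the bottom of block `i₁`. Taking `i₁ = i₀` shortens one
block twice, as in `λ''`; taking `i₁ ≠ i₀` shortens two blocks once, as in `λ'''`. -/
theorem quotKloosterman_jordanVec_pair (d : I → ℕ) (i₀ i₁ : I) (x y : ℕ) (hx : d i₀ = x + 1)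
    (hy : Function.update d i₀ x i₁ = y + 1) (z : jordanSpace F d)
    (hz : jordanDrop F d i₀ x hx.le z = jordanVec F i₁ 0 (by lia)) :
    quotKloosterman χ (algebraMap F _ α + jordanShift F d)
      (Submodule.span F {jordanVec F i₀ 0 (by lia), z}) =
    endKloosterman χ (algebraMap F _ α +
      jordanShift F (Function.update (Function.update d i₀ x) i₁ y)) := by
  refine quotKloosterman_eq χ (jordanDrop F _ i₁ y hy.le ∘ₗ jordanDrop F d i₀ x hx.le)
    ((jordanDrop_surjective _ i₁ y hy).comp (jordanDrop_surjective d i₀ x hx)) ?_ fun v => ?_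
  · rw [LinearMap.ker_comp, ker_jordanDrop _ i₁ y hy, ← hz, ← Set.image_singleton,
      ← Submodule.map_span, Submodule.comap_map_eq, ker_jordanDrop d i₀ x hx, sup_comm,
      ← Submodule.span_union]
    rfl
  · simp [jordanDrop_jordanShift]

end Vec

/-- The `m`-th power of the shift leaves only position `0` of each block of full size `m + 1`, and
the value there is arbitrary. -/
theorem card_range_jordanShift_pow [Finite I] {d : I → ℕ} {m : ℕ} (hd : ∀ i, d i ≤ m + 1) :
    Nat.card (LinearMap.range (jordanShift F d ^ m)) = Nat.card F ^ Nat.card {i // d i = m + 1} := by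
  rw [← Nat.card_fun]
  refine Nat.card_congr (Equiv.ofBijective
    (fun w (i : {i // d i = m + 1}) => ((w : jordanSpace F d) : I → ℕ → F) i 0) ⟨?_, ?_⟩)
  · rintro ⟨_, v, rfl⟩ ⟨_, w, rfl⟩ h
    ext i j
    change ((jordanShift F d ^ m) v : I → ℕ → F) i j = ((jordanShift F d ^ m) w : I → ℕ → F) i j
    by_cases hi : d i = m + 1 ∧ j = 0
    · obtain ⟨hi, rfl⟩ := hi
      exact congrFun h ⟨i, hi⟩
    · have hj : d i ≤ j + m := by have := hd i; lia
      rw [jordanShift_pow_apply, jordanShift_pow_apply, v.2 _ _ hj, w.2 _ _ hj]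
  · intro u
    refine ⟨⟨_, ⟨fun i j => if h : d i = m + 1 ∧ j = m then u ⟨i, h.1⟩ else 0, ?_⟩, rfl⟩, ?_⟩
    · intro i j h
      exact dif_neg (by lia)
    · funext i
      change ((jordanShift F d ^ m) _ : I → ℕ → F) i 0 = _
      rw [jordanShift_pow_apply]
      exact dif_pos ⟨i.2, by lia⟩

theorem exists_equiv_of_map_univ_eq {α β γ : Type*} [Fintype α] [Fintype β] {f : α → γ} {g : β → γ}
    (h : Finset.univ.val.map f = Finset.univ.val.map g) : ∃ e : α ≃ β, ∀ a, g (e a) = f a := by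
  classical
  have hc : ∀ c, Nonempty ({a // f a = c} ≃ {b // g b = c}) := by
    intro c
    have h1 := congrArg (Multiset.count c) h
    rw [Multiset.count_map, Multiset.count_map] at h1
    rw [← Fintype.card_eq, Fintype.card_subtype, Fintype.card_subtype]
    simpa only [Finset.card, Finset.filter_val, eq_comm] using h1
  exact ⟨Equiv.ofFiberEquiv fun c => (hc c).some, Equiv.ofFiberEquiv_map _⟩

/-- Empty blocks carry no coordinates, and the order of blocks is immaterial. This absorbs both the
reordering of parts and the deletion of `n_l - 2 = 0`. -/
theorem endKloosterman_jordanShift_congr {I' : Type*} [Fintype I] [Fintype I'] (χ : AddChar F ℂ)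
    (α : F) {d : I → ℕ} {d' : I' → ℕ}
    (h : (Finset.univ.val.map d).filter (· ≠ 0) = Finset.univ.val.map d') :
    endKloosterman χ (algebraMap F _ α + jordanShift F d) =
      endKloosterman χ (algebraMap F _ α + jordanShift F d') := by
  classical
  have h1 : Finset.univ.val.map (fun i : {i // d i ≠ 0} => d i) =
      (Finset.univ.val.map d).filter (· ≠ 0) := by
    rw [Multiset.filter_map]
    have := congrArg Finset.val (Finset.subtype_map (s := Finset.univ) (fun i => d i ≠ 0))
    rw [Finset.subtype_univ, Finset.map_val, Finset.filter_val] at this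
    change _ = Multiset.map d (Multiset.filter (fun i => d i ≠ 0) _)
    rw [← this, Multiset.map_map]
    rfl
  obtain ⟨e, he⟩ := exists_equiv_of_map_univ_eq (h.symm.trans h1.symm)
  let T : jordanSpace F d →ₗ[F] jordanSpace F d' :=
    { toFun v := ⟨fun i j => (v : I → ℕ → F) (e i) j, fun i j hj => v.2 _ _ (by rwa [he])⟩
      map_add' _ _ := rfl
      map_smul' _ _ := rfl }
  have hT : Function.Bijective T := by
    refine ⟨fun v w hvw => ?_, fun w => ?_⟩
    · ext i j
      by_cases hi : d i = 0
      · rw [v.2 i j (by lia), w.2 i j (by lia)]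
      · have := congrArg (fun u : jordanSpace F d' => (u : I' → ℕ → F) (e.symm ⟨i, hi⟩) j) hvw
        simpa [T] using this
    · refine ⟨⟨fun i j => if hi : d i ≠ 0 then (w : I' → ℕ → F) (e.symm ⟨i, hi⟩) j else 0, ?_⟩, ?_⟩
      · intro i j hj
        by_cases hi : d i ≠ 0
        · exact (dif_pos hi).trans (w.2 _ _ (by rw [← he]; simpa using hj))
        · exact dif_neg hi
      · ext i j
        have hi := (e i).2
        simp [T, hi]
  refine endKloosterman_congr χ (LinearEquiv.ofBijective T hT) fun v => ?_
  have : T (jordanShift F d v) = jordanShift F d' (T v) := rfl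
  simp [this]

end JordanModel

/-! ### From the Jordan matrix of a partition to the model -/

section Partition

variable {F : Type*} [Field F] {n : ℕ}

/-- The parts of a partition in non-decreasing order, as a composition. -/
def Nat.Partition.sortedComposition (lam : n.Partition) : Composition n where
  blocks := lam.parts.sort (· ≤ ·)
  blocks_pos h := lam.parts_pos (by simpa using h)
  blocks_sum := by
    rw [← Multiset.sum_coe, Multiset.sort_eq, lam.parts_sum]

theorem Nat.Partition.map_univ_sortedComposition (lam : n.Partition) :
    Finset.univ.val.map lam.sortedComposition.blocksFun = lam.parts := by
  rw [Fin.univ_val_map, Composition.ofFn_blocksFun]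
  exact Multiset.sort_eq _ _

/-- No partial sum lies strictly between two consecutive ones, so the superdiagonal entry vanishes
exactly at the last position of a block. -/
theorem Composition.exists_sizeUpTo_eq_iff (c : Composition n) (i : Fin c.length)
    (j : Fin (c.blocksFun i)) :
    (∃ i', c.sizeUpTo i' = (c.embedding i j : ℕ) + 1) ↔ (j : ℕ) + 1 = c.blocksFun i := by
  have hs := c.sizeUpTo_succ' i
  have hj := j.2
  rw [c.coe_embedding]
  constructor
  · rintro ⟨i', hi'⟩
    by_contra hne
    rcases Nat.lt_or_ge (i : ℕ) i' with h | h
    · have := c.monotone_sizeUpTo (Nat.succ_le_of_lt h)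
      simp only [Nat.succ_eq_add_one] at this
      lia
    · have := c.monotone_sizeUpTo h
      lia
  · intro h
    exact ⟨i + 1, by lia⟩

variable (F) in
/-- Splitting a vector into blocks. -/
noncomputable def Composition.jordanEquiv (c : Composition n) :
    (Fin n → F) ≃ₗ[F] jordanSpace F c.blocksFun where
  toFun w := ⟨fun i j => if h : j < c.blocksFun i then w (c.embedding i ⟨j, h⟩) else 0,
    fun i j h => dif_neg (not_lt.2 h)⟩
  map_add' v w := by
    ext i j
    by_cases h : j < c.blocksFun i <;> simp [h]
  map_smul' a v := by
    ext i j
    by_cases h : j < c.blocksFun i <;> simp [h]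
  invFun v r := (v : Fin c.length → ℕ → F) (c.index r) (c.invEmbedding r)
  left_inv w := by
    funext r
    simp only
    rw [dif_pos (c.invEmbedding r).2]
    exact congrArg w (c.embedding_comp_inv r)
  right_inv v := by
    ext i j
    simp only
    split_ifs with h
    · rw [c.invEmbedding_comp, c.index_embedding]
    · exact (v.2 i j (not_lt.1 h)).symm

theorem Composition.jordanEquiv_apply (c : Composition n) (w : Fin n → F) (i : Fin c.length)
    (j : ℕ) : (c.jordanEquiv F w : Fin c.length → ℕ → F) i j =
      if h : j < c.blocksFun i then w (c.embedding i ⟨j, h⟩) else 0 := rfl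

theorem jordanNilpotent_mulVec_embedding (lam : n.Partition) (w : Fin n → F)
    (i : Fin lam.sortedComposition.length) (j : Fin (lam.sortedComposition.blocksFun i)) :
    (jordanNilpotent F lam).mulVec w (lam.sortedComposition.embedding i j) =
      if h : (j : ℕ) + 1 < lam.sortedComposition.blocksFun i then
        w (lam.sortedComposition.embedding i ⟨j + 1, h⟩) else 0 := by
  have hiff := lam.sortedComposition.exists_sizeUpTo_eq_iff i j
  have hps : ∀ i', partialSum lam i' = lam.sortedComposition.sizeUpTo i' := fun _ => rfl
  have hj := j.2
  simp only [Matrix.mulVec, dotProduct, jordanNilpotent, Matrix.of_apply, hps, hiff]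
  split_ifs with h
  · rw [Fintype.sum_eq_single (lam.sortedComposition.embedding i ⟨j + 1, h⟩), if_pos, one_mul]
    · refine ⟨?_, by lia⟩
      rw [Composition.coe_embedding, Composition.coe_embedding]
      rfl
    · intro r hr
      rw [if_neg, zero_mul]
      rintro ⟨h1, -⟩
      apply hr
      ext
      rw [h1, Composition.coe_embedding, Composition.coe_embedding]
      rfl
  · refine Finset.sum_eq_zero fun r _ => ?_
    rw [if_neg, zero_mul]
    rintro ⟨-, h1⟩
    lia

theorem Composition.jordanEquiv_mulVec (lam : n.Partition) (w : Fin n → F) :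
    lam.sortedComposition.jordanEquiv F ((jordanNilpotent F lam).mulVec w) =
      jordanShift F _ (lam.sortedComposition.jordanEquiv F w) := by
  ext i j
  rw [jordanShift_apply, Composition.jordanEquiv_apply, Composition.jordanEquiv_apply]
  by_cases h : j < lam.sortedComposition.blocksFun i
  · rw [dif_pos h, jordanNilpotent_mulVec_embedding]
  · rw [dif_neg h, dif_neg (by lia)]

end Partition

/-! ### Transfer to the matrix sums and proof of the recursion -/

section Main

variable (p : ℕ) [Fact p.Prime] (F : Type u) [Field F] [Algebra (ZMod p) F]

/-- `fieldChar` as an additive character. -/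
noncomputable def fieldAddChar : AddChar F ℂ :=
  ZMod.stdAddChar.compAddMonoidHom (Algebra.trace (ZMod p) F).toAddMonoidHom

theorem fieldAddChar_apply (x : F) : fieldAddChar p F x = fieldChar p F x := rfl

/-- The trace of an extension of finite fields is surjective, and the standard character of `ZMod p`
is injective. -/
theorem fieldAddChar_ne_one [Finite F] : fieldAddChar p F ≠ 1 := by
  have : Module.Finite (ZMod p) F := Module.Finite.of_finite
  obtain ⟨x, hx⟩ := Algebra.trace_surjective (ZMod p) F 1
  intro h
  have h1 : ZMod.stdAddChar (N := p) 1 = 1 := by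
    have := DFunLike.congr_fun h x
    rw [fieldAddChar_apply, fieldChar, hx] at this
    exact this
  rw [← AddChar.map_zero_eq_one (ZMod.stdAddChar (N := p))] at h1
  exact one_ne_zero (ZMod.injective_stdAddChar h1)

variable {F}

theorem matrixKloosterman_eq_endKloosterman [Fintype F] {n : ℕ} (a : Matrix (Fin n) (Fin n) F) :
    matrixKloosterman p a = endKloosterman (fieldAddChar p F) (Matrix.toLin' a) := by
  classical
  have h := endKloosterman_eq_sum_matrix (fieldAddChar p F) (Pi.basisFun F (Fin n))
    (Matrix.toLin' a)
  rw [← Matrix.toLin_eq_toLin', LinearMap.toMatrix_toLin] at h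
  rw [← Matrix.toLin_eq_toLin', h]
  unfold matrixKloosterman
  congr!

theorem partitionKloosterman_eq_endKloosterman [Fintype F] {I : Type*} [Fintype I] {n : ℕ}
    (lam : n.Partition) (α : F) (d : I → ℕ)
    (hd : (Finset.univ.val.map d).filter (· ≠ 0) = lam.parts) :
    partitionKloosterman p lam α =
      endKloosterman (fieldAddChar p F) (algebraMap F _ α + jordanShift F d) := by
  rw [partitionKloosterman, matrixKloosterman_eq_endKloosterman,
    endKloosterman_jordanShift_congr _ _ (hd.trans lam.map_univ_sortedComposition.symm)]
  refine endKloosterman_congr _ (lam.sortedComposition.jordanEquiv F) fun v => ?_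
  rw [Matrix.toLin'_apply, Matrix.add_mulVec, map_add, Composition.jordanEquiv_mulVec]
  simp [Matrix.scalar_apply]

/-- Stated additively on both sides, so that multisets can be cancelled without subtraction. -/
theorem map_univ_update_add {I γ : Type*} [Fintype I] [DecidableEq I] (d : I → γ) (i : I) (x : γ) :
    Finset.univ.val.map (Function.update d i x) + {d i} = Finset.univ.val.map d + {x} := by
  have h : (Finset.univ : Finset I).val = i ::ₘ (Finset.univ.erase i).val := by
    rw [← Finset.insert_val_of_notMem (Finset.notMem_erase i _),
      Finset.insert_erase (Finset.mem_univ i)]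
  have h1 : (Finset.univ.erase i).val.map (Function.update d i x) =
      (Finset.univ.erase i).val.map d :=
    Multiset.map_congr rfl fun j hj =>
      Function.update_of_ne (Finset.ne_of_mem_erase (Finset.mem_def.2 hj)) _ _
  rw [h, Multiset.map_cons, Multiset.map_cons, h1, Function.update_self]
  simp only [← Multiset.singleton_add]
  abel

theorem sum_filter_ne_zero (t : Multiset ℕ) : (t.filter (· ≠ 0)).sum = t.sum := by
  induction t using Multiset.induction_on with
  | empty => rfl
  | cons a t ih =>
    by_cases ha : a = 0
    · rw [Multiset.filter_cons_of_neg (p := (· ≠ 0)) _ (not_not.2 ha), ih, ha, Multiset.sum_cons, zero_add]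
    · rw [Multiset.filter_cons_of_pos (p := (· ≠ 0)) _ ha, Multiset.sum_cons, Multiset.sum_cons, ih]

end Main

theorem mainTheorem11 {n : ℕ} (lam : n.Partition)
    -- `λ = [n₁^{k₁}, …, n_{l-1}^{k_{l-1}}, m^k]`, where `s` collects the parts smaller than `m = n_l`
    (s : Multiset ℕ) (m k : ℕ) (hs : ∀ i ∈ s, i < m)
    (hlam : lam.parts = s + Multiset.replicate k m) (hm : 2 ≤ m) (hk : 1 < k) :
    ∃ (lam' : (n - 1).Partition) (lam'' lam''' : (n - 2).Partition),
      lam'.parts = s + {m - 1} + Multiset.replicate (k - 1) m ∧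
      lam''.parts = (s + {m - 2} + Multiset.replicate (k - 1) m).filter (· ≠ 0) ∧
      lam'''.parts = s + Multiset.replicate 2 (m - 1) + Multiset.replicate (k - 2) m ∧
      -- the identity of Kloosterman sums
      (∀ (p : ℕ) [Fact p.Prime] (F : Type u) [Field F] [Algebra (ZMod p) F] [Fintype F] (α : F),
        α ≠ 0 →
          partitionKloosterman p lam α =
            (Fintype.card F : ℂ) ^ (n - 1) * kloosterman p F α * partitionKloosterman p lam' α
            - (Fintype.card F : ℂ) ^ (2 * n - 2) * partitionKloosterman p lam'' α
            - ((Fintype.card F : ℂ) ^ (k - 1) - 1) * (Fintype.card F : ℂ) ^ (2 * n - 2) *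
              (partitionKloosterman p lam'' α - partitionKloosterman p lam''' α)) ∧
      -- the recursion for the polynomials in `ℤ[A, G, K]` that express these sums
      (∀ P' P'' P''' : MvPolynomial (Fin 3) ℤ,
        Expresses.{u} P' lam' → Expresses.{u} P'' lam'' → Expresses.{u} P''' lam''' →
          Expresses.{u}
            (MvPolynomial.X 0 ^ (n - 1) * MvPolynomial.X 2 * P'
              - MvPolynomial.X 0 ^ (2 * n - 2) * P''
              - (MvPolynomial.X 0 ^ (k - 1) - 1) * MvPolynomial.X 0 ^ (2 * n - 2) * (P'' - P'''))
            lam) := by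
  obtain ⟨μ, rfl⟩ := Nat.exists_eq_add_of_le' hm
  obtain ⟨ν, rfl⟩ : ∃ ν, k = ν + 2 := Nat.exists_eq_add_of_le' (Nat.succ_le_of_lt hk)
  have hs0 : ∀ i ∈ s, 0 < i := fun i hi =>
    lam.parts_pos (by rw [hlam]; exact Multiset.mem_add.2 (Or.inl hi))
  have hsum : s.sum + (ν + 2) * (μ + 2) = n := by
    rw [← lam.parts_sum, hlam]
    simp only [Multiset.sum_add, Multiset.sum_replicate, smul_eq_mul]
  have hn : ν * μ + 2 * ν + 2 * μ + 4 + s.sum = n := by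
    rw [← hsum]
    ring
  simp only [show μ + 2 - 1 = μ + 1 by lia, show μ + 2 - 2 = μ by lia,
    show ν + 2 - 1 = ν + 1 by lia, show ν + 2 - 2 = ν by lia]
  let lam' : (n - 1).Partition :=
    { parts := s + {μ + 1} + Multiset.replicate (ν + 1) (μ + 2)
      parts_pos := by
        intro i hi
        simp only [Multiset.mem_add, Multiset.mem_singleton, Multiset.mem_replicate] at hi
        rcases hi with (hi | hi) | hi
        · exact hs0 i hi
        · lia
        · lia
      parts_sum := by
        simp
        ring_nf
        lia }
  let lam'' : (n - 2).Partition :=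
    { parts := (s + {μ} + Multiset.replicate (ν + 1) (μ + 2)).filter (· ≠ 0)
      parts_pos := by
        intro i hi
        exact Nat.pos_of_ne_zero (Multiset.mem_filter.1 hi).2
      parts_sum := by
        rw [sum_filter_ne_zero]
        simp
        ring_nf
        lia }
  let lam''' : (n - 2).Partition :=
    { parts := s + Multiset.replicate 2 (μ + 1) + Multiset.replicate ν (μ + 2)
      parts_pos := by
        intro i hi
        simp only [Multiset.mem_add, Multiset.mem_replicate] at hi
        rcases hi with (hi | hi) | hi
        · exact hs0 i hi
        · lia
        · lia
      parts_sum := by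
        simp
        ring_nf
        lia }
  have hmain : ∀ (p : ℕ) [Fact p.Prime] (F : Type u) [Field F] [Algebra (ZMod p) F] [Fintype F]
      (α : F), α ≠ 0 →
      partitionKloosterman p lam α =
        (Fintype.card F : ℂ) ^ (n - 1) * kloosterman p F α * partitionKloosterman p lam' α
        - (Fintype.card F : ℂ) ^ (2 * n - 2) * partitionKloosterman p lam'' α
        - ((Fintype.card F : ℂ) ^ (ν + 1) - 1) * (Fintype.card F : ℂ) ^ (2 * n - 2) *
          (partitionKloosterman p lam'' α - partitionKloosterman p lam''' α) := by
    intro p _ F _ _ _ α hα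
    classical
    set d := lam.sortedComposition.blocksFun with hd
    have hmap : Finset.univ.val.map d = s + Multiset.replicate (ν + 2) (μ + 2) :=
      lam.map_univ_sortedComposition.trans hlam
    have hdm : ∀ i, d i ≤ μ + 2 := by
      intro i
      have hi : d i ∈ Finset.univ.val.map d := Multiset.mem_map_of_mem d (Finset.mem_univ_val i)
      rw [hmap, Multiset.mem_add, Multiset.mem_replicate] at hi
      rcases hi with hi | hi
      · exact (hs _ hi).le
      · exact hi.2.le
    have hcard : Nat.card {i // d i = μ + 2} = ν + 2 := by
      have h := congrArg (Multiset.count (μ + 2)) hmap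
      rw [Multiset.count_map, Multiset.count_add, Multiset.count_replicate_self,
        Multiset.count_eq_zero_of_notMem (fun h => (hs _ h).false), zero_add] at h
      rw [Nat.card_eq_fintype_card, Fintype.card_subtype, ← h]
      simp only [Finset.card, Finset.filter_val, eq_comm]
    have hnt : Nontrivial {i // d i = μ + 2} := by
      rw [← Finite.one_lt_card_iff_nontrivial, hcard]
      lia
    -- This is where `k_l > 1` enters: a second block of maximal size supplies a vector `e₂` of top
    -- height outside `⟨e⟩`.
    obtain ⟨⟨i₀, h₀⟩, ⟨i₁, h₁⟩, hne⟩ := exists_pair_ne {i // d i = μ + 2}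
    have hi : i₁ ≠ i₀ := fun h => hne (Subtype.ext h.symm)
    have hup : Function.update d i₀ (μ + 1) i₁ = μ + 2 := by rw [Function.update_of_ne hi, h₁]
    have hm' : Finset.univ.val.map (Function.update d i₀ (μ + 1)) =
        s + {μ + 1} + Multiset.replicate (ν + 1) (μ + 2) := by
      have h := map_univ_update_add d i₀ (μ + 1)
      rw [hmap, h₀, Multiset.replicate_succ, ← Multiset.singleton_add] at h
      refine add_right_cancel (b := {μ + 2}) (h.trans ?_)
      abel
    have hm'' : Finset.univ.val.map (Function.update (Function.update d i₀ (μ + 1)) i₀ μ) =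
        s + {μ} + Multiset.replicate (ν + 1) (μ + 2) := by
      have h := map_univ_update_add (Function.update d i₀ (μ + 1)) i₀ μ
      rw [hm', Function.update_self] at h
      refine add_right_cancel (b := {μ + 1}) (h.trans ?_)
      abel
    have hm''' : Finset.univ.val.map (Function.update (Function.update d i₀ (μ + 1)) i₁ (μ + 1)) =
        s + Multiset.replicate 2 (μ + 1) + Multiset.replicate ν (μ + 2) := by
      have h := map_univ_update_add (Function.update d i₀ (μ + 1)) i₁ (μ + 1)
      rw [hm', hup, Multiset.replicate_succ, ← Multiset.singleton_add] at h
      refine add_right_cancel (b := {μ + 2}) (h.trans ?_)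
      rw [Multiset.replicate_succ, Multiset.replicate_one, ← Multiset.singleton_add]
      abel
    have hfilter : ∀ {r : ℕ} (ρ : r.Partition), ρ.parts.filter (· ≠ 0) = ρ.parts := fun ρ =>
      Multiset.filter_eq_self.2 fun i hi => (ρ.parts_pos hi).ne'
    rw [partitionKloosterman_eq_endKloosterman p lam α d (by rw [hmap, ← hlam, hfilter]),
      partitionKloosterman_eq_endKloosterman p lam' α _ (by rw [hm']; exact hfilter lam'),
      partitionKloosterman_eq_endKloosterman p lam'' α _ (by rw [hm'']),
      partitionKloosterman_eq_endKloosterman p lam''' α _ (by rw [hm''']; exact hfilter lam''')]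
    have hfin : finrank F (jordanSpace F d) = n := by
      rw [← (lam.sortedComposition.jordanEquiv F).finrank_eq, finrank_fin_fun]
    have hN := jordanShift_pow_eq_zero (F := F) hdm
    -- With `f₀` at the top position `μ + 1` of block `i₀`, the vector `e` is at position `0` and
    -- `y₀` at position `1`; `e₂` is at position `0` of block `i₁`.
    have he := jordanShift_pow_jordanVec (F := F) (d := d) (μ + 1) i₀ (j := 0) (l := μ + 1)
      (by lia) (by lia)
    have hy := jordanShift_pow_jordanVec (F := F) (d := d) μ i₀ (j := 1) (l := μ + 1)
      (by lia) (by lia)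
    have he₂ := jordanShift_pow_jordanVec (F := F) (d := d) (μ + 1) i₁ (j := 0) (l := μ + 1)
      (by lia) (by lia)
    have hrec := endKloosterman_recursion (fieldAddChar_ne_one p F) hα hN
      (f₀ := jordanVec F i₀ (μ + 1) (by lia)) (e₂ := jordanVec F i₁ 0 (by lia))
      (by rw [he]; exact jordanVec_ne_zero _ _ _) ⟨_, he₂⟩
      (by rw [he]; exact jordanVec_notMem_span hi _ _)
    rw [he, hy, hfin, card_range_jordanShift_pow hdm, hcard,
      quotKloosterman_jordanVec _ _ d i₀ (μ + 1) h₀,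
      quotKloosterman_jordanVec_pair _ _ d i₀ i₀ (μ + 1) μ h₀ (Function.update_self _ _ _) _
        (jordanDrop_jordanVec_self i₀ _ _ 0 _),
      quotKloosterman_jordanVec_pair _ _ d i₀ i₁ (μ + 1) (μ + 1) h₀ hup _
        (jordanDrop_jordanVec_of_ne hi _ _ 0 _)] at hrec
    have hK : kloosterman p F α =
        ∑ s : Fˣ, fieldAddChar p F (α * (s : F) + (s : F)⁻¹) := by
      unfold kloosterman
      simp only [fieldAddChar_apply]
    -- The count gives `q^(2(n-2)+1) ((q^k - q) K_λ''' - q^k K_λ'')` with `k = ν + 2`; taking out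
    -- one factor `q` yields the stated form.
    rw [hrec, hK, Nat.card_eq_fintype_card, show 2 * n - 2 = 2 * (n - 2) + 2 by lia]
    push_cast
    ring
  refine ⟨lam', lam'', lam''', rfl, rfl, rfl, hmain, ?_⟩
  intro P' P'' P''' h' h'' h''' p _ F _ _ _ α hα
  rw [hmain p F α hα, h' p F α hα, h'' p F α hα, h''' p F α hα]
  simp
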